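/- Let $\mu$ be the Haar probability measure of the rotation group $SO(3)$, $\|\cdot\|_2$ the norm of $L^2(SO(3),\mu)$ and $(g*h)(x)=\int g(y)\,h(y^{-1}x)\,d\mu(y)$. For $\ell\ge 0$ let $D^\ell_{nm}$ ($-\ell\le n,m\le\ell$) be the Wigner functions, given in ZYZ Euler angles by $D^\ell_{nm}=e^{-in\varphi}P^\ell_{nm}(\cos\theta)e^{-im\psi}$ and normalized by $\|D^\ell_{nm}\|_2^2=(2\ell+1)^{-1}$, and let $\chi^\ell(x)=\sum_n D^\ell_{nn}(x)=\frac{\sin((\ell+\frac12)\omega(x))}{\sin(\omega(x)/2)}$ be the character, where $\omega(x)$ is the rotation angle of $x$. For a function $f$ put $$\hat f^\ell_{nm}=\int f\,\overline{D^\ell_{nm}}\,d\mu,\qquad \hat f_\ell^{\,2}=\frac1{2\ell+1}\sum_{n,m=-\ell}^{\ell}|\hat f^\ell_{nm}|^2 .$$ For $t,\rho>0$ let $$\kappa_t=\sum_{\ell\ge0}(2\ell+1)e^{-\ell(\ell+1)t}\chi^\ell,\qquad \Psi_\rho=\frac1{\sqrt{\alpha(\rho)}}\sum_{\ell\ge0}(2\ell+1)\sqrt{\ell(\ell+1)}\,e^{-\ell(\ell+1)\rho/2}\chi^\ell,$$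 with $\alpha(\rho)=\sum_{\ell\ge0}(2\ell+1)^2\ell(\ell+1)e^{-\ell(\ell+1)\rho}$, be the heat kernel and the heat wavelets, and $\check\Psi_\rho(g)=\overline{\Psi_\rho(g^{-1})}$. Let $f\in L^2(SO(3),\mathbb R)$ be a probability density with respect to $\mu$, and let $X_1,\dots,X_K$ ($K\ge1$) be independent random rotations with density $f$. The heat wavelet estimator at scale $t>0$ is $$\zeta_K(x,t)=1+\frac1K\sum_{k=1}^K\int_t^{\infty}\!\int_{SO(3)}\check\Psi_\rho(X_k^{-1}y)\,\Psi_\rho(y^{-1}x)\,d\mu(y)\,\alpha(\rho)\,d\rho ,$$ where the constant $1=\int f\,d\mu$ is the mean of $f$ (the wavelets have mean zero), and $\mathrm{MISE}(t)=\mathbb E\,\|\zeta_K(\cdot,t)-f\|_2^2$. Then, for every $t>0$: 1. $\zeta_K(x,t)=\frac1K\sum_{k=1}^K\kappa_t(X_k^{-1}x)$ and $\mathbb E[\zeta_K(x,t)]=(f*\kappa_t)(x)$ for all $x$. 2. The squared bias $\|f-\mathbb E\,\zeta_K\|_2^2$ equals $\|f-f*\kappa_t\|_2^2$, the variance term $\mathbb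 E\|\zeta_K-\mathbb E\,\zeta_K\|_2^2$ is finite and equals $\frac1K\left(\|\kappa_t\|_2^2-\|f*\kappa_t\|_2^2\right)$ (both norms being finite), and $\mathrm{MISE}(t)$ is the sum of these two terms. 3. $\mathrm{MISE}(t)$ is finite and is the sum of the convergent series $$\mathrm{MISE}(t)=\sum_{\ell\ge1}\left[(2\ell+1)^2\,\hat f_\ell^{\,2}\,\bigl(1-e^{-\ell(\ell+1)t}\bigr)^2+\frac{(2\ell+1)^2}{K}\,e^{-2\ell(\ell+1)t}\,\bigl(1-\hat f_\ell^{\,2}\bigr)\right].$$ Moreover $\hat f_\ell^{\,2}\le1$ for all $\ell\ge1$, and as $t\to0^+$ one has, in $[0,\infty]$, $$\mathrm{MISE}(t)\longrightarrow\sum_{\ell\ge1}\frac{(2\ell+1)^2}{K}\bigl(1-\hat f_\ell^{\,2}\bigr)=+\infty .$$ -/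

import Mathlib

open MeasureTheory ProbabilityTheory Filter Topology
open scoped ENNReal

noncomputable section

/-! ### The rotation group -/

/-- The rotation group of `ℝ³`, as real orthogonal `3 × 3` matrices of determinant one. -/
abbrev SO3 : Type := Matrix.specialOrthogonalGroup (Fin 3) ℝ

theorem SO3.mul_transpose (x : SO3) : x.1 * x.1.transpose = 1 :=
  (Matrix.mem_orthogonalGroup_iff (Fin 3) ℝ).1 x.2.1

theorem SO3.transpose_mul (x : SO3) : x.1.transpose * x.1 = 1 :=
  (Matrix.mem_orthogonalGroup_iff' (Fin 3) ℝ).1 x.2.1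

theorem SO3.det_eq_one (x : SO3) : x.1.det = 1 := x.2.2

theorem SO3.coe_inv (x : SO3) : (x⁻¹).1 = x.1.transpose := by
  ext i j; rfl

instance : IsTopologicalGroup SO3 where
  continuous_mul := by
    refine Continuous.subtype_mk ?_ _
    exact (continuous_subtype_val.comp continuous_fst).mul
      (continuous_subtype_val.comp continuous_snd)
  continuous_inv := by
    rw [continuous_induced_rng]
    have : (Subtype.val ∘ fun a : SO3 => a⁻¹) = fun a : SO3 => a.1.transpose := by
      funext a; exact SO3.coe_inv a
    rw [this]
    exact continuous_subtype_val.matrix_transpose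

theorem SO3.entry_sq_le (x : SO3) (i j : Fin 3) : (x.1 i j) ^ 2 ≤ 1 := by
  have h := congrFun (congrFun x.mul_transpose i) i
  simp only [Matrix.mul_apply, Matrix.transpose_apply, Fin.sum_univ_three,
    Matrix.one_apply_eq] at h
  fin_cases j <;> simp only [Fin.zero_eta, Fin.mk_one, Fin.reduceFinMk] <;>
    nlinarith [sq_nonneg (x.1 i 0), sq_nonneg (x.1 i 1), sq_nonneg (x.1 i 2)]

instance : CompactSpace SO3 := by
  refine (isCompact_iff_compactSpace (s := (Matrix.specialOrthogonalGroup (Fin 3) ℝ :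
    Set (Matrix (Fin 3) (Fin 3) ℝ)))).1 ?_
  have hK : IsCompact (Set.univ.pi fun _ : Fin 3 => Set.univ.pi fun _ : Fin 3 =>
      Set.Icc (-1 : ℝ) 1) :=
    isCompact_univ_pi fun _ => isCompact_univ_pi fun _ => isCompact_Icc
  refine hK.of_isClosed_subset ?_ ?_
  · have : (Matrix.specialOrthogonalGroup (Fin 3) ℝ : Set (Matrix (Fin 3) (Fin 3) ℝ)) =
        {A | A * A.transpose = 1} ∩ {A | A.det = 1} := by
      ext A
      exact and_congr (Matrix.mem_orthogonalGroup_iff (Fin 3) ℝ) Iff.rfl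
    rw [this]
    exact (isClosed_eq (continuous_id.mul continuous_id.matrix_transpose)
      continuous_const).inter (isClosed_eq continuous_id.matrix_det continuous_const)
  · intro A hA i _ j _
    exact abs_le.1 ((sq_le_one_iff_abs_le_one _).1 (SO3.entry_sq_le ⟨A, hA⟩ i j))

instance : MeasurableSpace SO3 := borel SO3

instance : BorelSpace SO3 := ⟨rfl⟩

/-- The bi-invariant Haar measure of `SO(3)`, of total mass one. -/
def SO3.haar : Measure SO3 := Measure.haarMeasure ⊤

/-! ### Euler angles -/

/-- Rotation by the angle `a` about the third axis. -/
def rotZ (a : ℝ) : Matrix (Fin 3) (Fin 3) ℝ :=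
  !![Real.cos a, -Real.sin a, 0; Real.sin a, Real.cos a, 0; 0, 0, 1]

/-- Rotation by the angle `a` about the second axis. -/
def rotY (a : ℝ) : Matrix (Fin 3) (Fin 3) ℝ :=
  !![Real.cos a, 0, Real.sin a; 0, 1, 0; -Real.sin a, 0, Real.cos a]

/-- `(φ, θ, ψ)` are Euler angles of `x` in the ZYZ convention. -/
def IsEulerZYZ (x : SO3) (e : ℝ × ℝ × ℝ) : Prop :=
  e.1 ∈ Set.Ico 0 (2 * Real.pi) ∧ e.2.1 ∈ Set.Icc 0 Real.pi ∧
    e.2.2 ∈ Set.Ico 0 (2 * Real.pi) ∧ x.1 = rotZ e.1 * rotY e.2.1 * rotZ e.2.2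

theorem exists_polar (a b r : ℝ) (hr : 0 ≤ r) (h : a ^ 2 + b ^ 2 = r ^ 2) :
    ∃ u ∈ Set.Ico 0 (2 * Real.pi), a = r * Real.cos u ∧ b = r * Real.sin u := by
  set z : ℂ := ⟨a, b⟩ with hz
  have hn : ‖z‖ = r := by
    have h1 : ‖z‖ ^ 2 = r ^ 2 := by
      rw [Complex.sq_norm, Complex.normSq_apply, ← h, hz]; ring
    exact (sq_eq_sq₀ (norm_nonneg z) hr).1 h1
  have h2 := toIcoMod_add_toIcoDiv_zsmul Real.two_pi_pos 0 (Complex.arg z)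
  set n := toIcoDiv Real.two_pi_pos 0 (Complex.arg z)
  have hm := toIcoMod_mem_Ico Real.two_pi_pos 0 (Complex.arg z)
  refine ⟨toIcoMod Real.two_pi_pos 0 (Complex.arg z), by simpa using hm, ?_, ?_⟩
  · have h3 : Real.cos (toIcoMod Real.two_pi_pos 0 (Complex.arg z)) = Real.cos z.arg := by
      conv_rhs => rw [← h2, zsmul_eq_mul, Real.cos_add_int_mul_two_pi]
    rw [h3, ← hn, Complex.norm_mul_cos_arg]
  · have h3 : Real.sin (toIcoMod Real.two_pi_pos 0 (Complex.arg z)) = Real.sin z.arg := by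
      conv_rhs => rw [← h2, zsmul_eq_mul, Real.sin_add_int_mul_two_pi]
    rw [h3, ← hn, Complex.norm_mul_sin_arg]

theorem rotZ_mul_neg (a : ℝ) : rotZ a * rotZ (-a) = 1 := by
  have h := Real.sin_sq_add_cos_sq a
  ext i j
  fin_cases i <;> fin_cases j <;>
    simp [rotZ, Matrix.mul_apply, Fin.sum_univ_three] <;> nlinarith

theorem rotY_mul_neg (a : ℝ) : rotY a * rotY (-a) = 1 := by
  have h := Real.sin_sq_add_cos_sq a
  ext i j
  fin_cases i <;> fin_cases j <;>
    simp [rotY, Matrix.mul_apply, Fin.sum_univ_three] <;> nlinarith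

theorem transpose_rotZ (a : ℝ) : (rotZ a).transpose = rotZ (-a) := by
  ext i j
  fin_cases i <;> fin_cases j <;> simp [rotZ]

theorem transpose_rotY (a : ℝ) : (rotY a).transpose = rotY (-a) := by
  ext i j
  fin_cases i <;> fin_cases j <;> simp [rotY]

theorem det_rotZ (a : ℝ) : (rotZ a).det = 1 := by
  have h := Real.sin_sq_add_cos_sq a
  simp [rotZ, Matrix.det_fin_three]; nlinarith

theorem det_rotY (a : ℝ) : (rotY a).det = 1 := by
  have h := Real.sin_sq_add_cos_sq a
  simp [rotY, Matrix.det_fin_three]; nlinarith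

theorem exists_isEulerZYZ (x : SO3) : ∃ e, IsEulerZYZ x e := by
  have hc : x.1 0 2 ^ 2 + x.1 1 2 ^ 2 + x.1 2 2 ^ 2 = 1 := by
    have h := congrFun (congrFun x.transpose_mul 2) 2
    simp only [Matrix.mul_apply, Matrix.transpose_apply, Fin.sum_univ_three,
      Matrix.one_apply_eq] at h
    nlinarith
  have hb := abs_le.1 ((sq_le_one_iff_abs_le_one _).1 (x.entry_sq_le 2 2))
  set θ := Real.arccos (x.1 2 2) with hθ
  have hcos : Real.cos θ = x.1 2 2 := Real.cos_arccos hb.1 hb.2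
  have hs0 : 0 ≤ Real.sin θ := Real.sin_nonneg_of_nonneg_of_le_pi
    (Real.arccos_nonneg _) (Real.arccos_le_pi _)
  have hsc := Real.sin_sq_add_cos_sq θ
  obtain ⟨φ, hφ, h0, h1⟩ := exists_polar (x.1 0 2) (x.1 1 2) (Real.sin θ) hs0 (by
    rw [hcos] at hsc; linarith)
  have hscφ := Real.sin_sq_add_cos_sq φ
  set A := rotY (-θ) * rotZ (-φ) * x.1 with hA
  have hx : x.1 = rotZ φ * rotY θ * A := by
    rw [hA, show rotZ φ * rotY θ * (rotY (-θ) * rotZ (-φ) * x.1) =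
      rotZ φ * (rotY θ * rotY (-θ)) * rotZ (-φ) * x.1 by simp only [Matrix.mul_assoc],
      rotY_mul_neg, Matrix.mul_one, rotZ_mul_neg, Matrix.one_mul]
  have hAA : A * A.transpose = 1 := by
    rw [hA, Matrix.transpose_mul, Matrix.transpose_mul, transpose_rotZ, transpose_rotY,
      show rotY (-θ) * rotZ (-φ) * x.1 * (x.1.transpose * (rotZ (- -φ) * rotY (- -θ))) =
        rotY (-θ) * (rotZ (-φ) * (x.1 * x.1.transpose) * rotZ (- -φ)) * rotY (- -θ) by
        simp only [Matrix.mul_assoc],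
      x.mul_transpose, Matrix.mul_one, rotZ_mul_neg, Matrix.mul_one, rotY_mul_neg]
  have hdet : A.det = 1 := by
    rw [hA, Matrix.det_mul, Matrix.det_mul, det_rotY, det_rotZ, x.det_eq_one]; norm_num
  have a02 : A 0 2 = 0 := by
    simp only [hA, Matrix.mul_apply, Fin.sum_univ_three]
    simp [rotZ, rotY]
    rw [h0, h1, ← hcos]; linear_combination Real.cos θ * Real.sin θ * hscφ
  have a12 : A 1 2 = 0 := by
    simp only [hA, Matrix.mul_apply, Fin.sum_univ_three]
    simp [rotZ, rotY]
    rw [h0, h1]; ring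
  have a22 : A 2 2 = 1 := by
    simp only [hA, Matrix.mul_apply, Fin.sum_univ_three]
    simp [rotZ, rotY]
    rw [h0, h1, ← hcos]; linear_combination Real.sin θ ^ 2 * hscφ + hsc
  have e (i j : Fin 3) := congrFun (congrFun hAA i) j
  have e00 := e 0 0
  have e01 := e 0 1
  have e11 := e 1 1
  have e22 := e 2 2
  simp [Matrix.mul_apply, Fin.sum_univ_three, a02, a12, a22] at e00 e01 e11 e22
  have a20 : A 2 0 = 0 := by nlinarith [mul_self_nonneg (A 2 0), mul_self_nonneg (A 2 1)]
  have a21 : A 2 1 = 0 := by nlinarith [mul_self_nonneg (A 2 0), mul_self_nonneg (A 2 1)]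
  rw [Matrix.det_fin_three, a02, a12, a22, a20, a21] at hdet
  have b1 : A 1 1 = A 0 0 := by
    linear_combination (-A 1 1) * e00 + A 0 1 * e01 + A 0 0 * hdet
  have b2 : A 0 1 = - A 1 0 := by
    linear_combination (-A 1 0) * e00 + A 0 0 * e01 - A 0 1 * hdet
  obtain ⟨ψ, hψ, p0, p1⟩ := exists_polar (A 0 0) (A 1 0) 1 zero_le_one (by
    rw [b2] at e00; linarith)
  rw [one_mul] at p0 p1
  refine ⟨(φ, θ, ψ), hφ, ⟨Real.arccos_nonneg _, Real.arccos_le_pi _⟩, hψ, ?_⟩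
  have : A = rotZ ψ := by
    ext i j
    fin_cases i <;> fin_cases j <;> simp [rotZ, a02, a12, a22, a20, a21, b1, b2, p0, p1]
  rw [hx, this]

/-- ZYZ Euler angles `(φ, θ, ψ)` of a rotation; where they are not unique (`θ = 0` or `θ = π`) the
functions `wignerD` below do not depend on the choice. -/
def eulerZYZ (x : SO3) : ℝ × ℝ × ℝ := Classical.choose (exists_isEulerZYZ x)

theorem eulerZYZ_spec (x : SO3) : IsEulerZYZ x (eulerZYZ x) :=
  Classical.choose_spec (exists_isEulerZYZ x)

/-! ### Fourier coefficients on `SO(3)` -/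

/-- Wigner's function `d^ℓ_{nm}(θ)`, that is, the generalized Legendre function
`P^ℓ_{nm}(cos θ)`. The indices `i, j ∈ {0, …, 2ℓ}` stand for `n = i - ℓ` and `m = j - ℓ`. With
`c = cos (θ/2)`, `s = sin (θ/2)` it is the square root of
`(ℓ+n)! (ℓ-n)! / ((ℓ+m)! (ℓ-m)!)` times the coefficient of `X^(ℓ+n)` in
`(c X + s)^(ℓ+m) (-s X + c)^(ℓ-m)`; expanding gives Wigner's sum. -/
def wignerSmallD (ℓ : ℕ) (i j : Fin (2 * ℓ + 1)) (θ : ℝ) : ℝ :=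
  Real.sqrt (((i : ℕ).factorial * (2 * ℓ - (i : ℕ)).factorial : ℝ) /
      ((j : ℕ).factorial * (2 * ℓ - (j : ℕ)).factorial : ℝ)) *
    ((Polynomial.C (Real.cos (θ / 2)) * Polynomial.X + Polynomial.C (Real.sin (θ / 2))) ^ (j : ℕ) *
      (Polynomial.C (-Real.sin (θ / 2)) * Polynomial.X +
        Polynomial.C (Real.cos (θ / 2))) ^ (2 * ℓ - (j : ℕ))).coeff (i : ℕ)

/-- The Wigner function `D^ℓ_{nm}(x) = e^{-i n φ} P^ℓ_{nm}(cos θ) e^{-i m ψ}`, where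
`n = i - ℓ` and `m = j - ℓ`. -/
def wignerD (ℓ : ℕ) (i j : Fin (2 * ℓ + 1)) (x : SO3) : ℂ :=
  Complex.exp (-Complex.I * (((i : ℕ) : ℂ) - (ℓ : ℂ)) * ((eulerZYZ x).1 : ℂ)) *
    (wignerSmallD ℓ i j (eulerZYZ x).2.1 : ℂ) *
    Complex.exp (-Complex.I * (((j : ℕ) : ℂ) - (ℓ : ℂ)) * ((eulerZYZ x).2.2 : ℂ))

/-- The Fourier coefficient `⟨f, D^ℓ_{nm}⟩`. -/
def fourierCoeffSO3 (f : SO3 → ℝ) (ℓ : ℕ) (i j : Fin (2 * ℓ + 1)) : ℂ :=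
  ∫ x, (f x : ℂ) * (starRingEnd ℂ) (wignerD ℓ i j x) ∂SO3.haar

/-- The number written `(f̂^ℓ)²`: the sum of the `|f̂^ℓ_{nm}|²` divided by `2ℓ+1`. -/
def fourierSq (f : SO3 → ℝ) (ℓ : ℕ) : ℝ :=
  (2 * (ℓ : ℝ) + 1)⁻¹ * ∑ i, ∑ j, ‖fourierCoeffSO3 f ℓ i j‖ ^ 2

/-- Convolution on `SO(3)`. -/
def convSO3 (f h : SO3 → ℝ) (x : SO3) : ℝ := ∫ g, f g * h (g⁻¹ * x) ∂SO3.haar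

/-- The squared `L²` norm on `SO(3)`, with values in `[0, ∞]`. -/
def normSqSO3 (h : SO3 → ℝ) : ℝ≥0∞ := ∫⁻ x, ENNReal.ofReal (h x ^ 2) ∂SO3.haar

/-! ### Heat kernel and heat wavelets -/

/-- The rotation angle, given by `cos ω = (tr x - 1) / 2`, in `[0, π]`. -/
def rotAngle (x : SO3) : ℝ := Real.arccos ((x.1.trace - 1) / 2)

/-- The character `χ^ℓ(x) = U_{2ℓ}(cos (ω(x)/2)) = sin ((ℓ + 1/2) ω(x)) / sin (ω(x)/2)`. -/
def charSO3 (ℓ : ℕ) (x : SO3) : ℝ :=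
  (Polynomial.Chebyshev.U ℝ (2 * (ℓ : ℤ))).eval (Real.cos (rotAngle x / 2))

/-- The heat kernel `κ_t`. -/
def heatKernelSO3 (t : ℝ) (x : SO3) : ℝ :=
  ∑' ℓ : ℕ, (2 * (ℓ : ℝ) + 1) * Real.exp (-((ℓ : ℝ) * (ℓ + 1) * t)) * charSO3 ℓ x

/-- The normalizing factor `α(ρ)` of the heat wavelets. -/
def waveletAlpha (ρ : ℝ) : ℝ :=
  ∑' ℓ : ℕ, (2 * (ℓ : ℝ) + 1) ^ 2 * ((ℓ : ℝ) * (ℓ + 1)) * Real.exp (-((ℓ : ℝ) * (ℓ + 1) * ρ))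

/-- The heat wavelet `Ψ_ρ`. -/
def heatWavelet (ρ : ℝ) (x : SO3) : ℝ :=
  (Real.sqrt (waveletAlpha ρ))⁻¹ *
    ∑' ℓ : ℕ, (2 * (ℓ : ℝ) + 1) * Real.sqrt ((ℓ : ℝ) * (ℓ + 1)) *
      Real.exp (-((ℓ : ℝ) * (ℓ + 1) / 2 * ρ)) * charSO3 ℓ x

/-- The empirical wavelet transform of a sample `s`: the mean over `k` of
`Ψ̌_ρ(s_k⁻¹ y)`, where `Ψ̌_ρ(g) = Ψ_ρ(g⁻¹)`. -/
def empiricalWT {K : ℕ} (s : Fin K → SO3) (ρ : ℝ) (y : SO3) : ℝ :=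
  (K : ℝ)⁻¹ * ∑ k, heatWavelet ρ (((s k)⁻¹ * y)⁻¹)

/-- The heat wavelet estimator at scale `t` built from the sample `s`: the wavelet inversion
formula, integrated over the scales `ρ > t`, with the wavelet transform replaced by the empirical
one. The heat wavelets have mean zero, so the inversion formula recovers a density up to its
mean, which is the constant `1`. -/
def heatWaveletEstimator {K : ℕ} (s : Fin K → SO3) (t : ℝ) (x : SO3) : ℝ :=
  1 + ∫ ρ in Set.Ioi t,
    (∫ y, empiricalWT s ρ y * heatWavelet ρ (y⁻¹ * x) ∂SO3.haar) * waveletAlpha ρ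

/-! ### Mean integrated squared error -/

/-- The expected value of the estimator at the point `x`. -/
def meanEstimator {Ω : Type*} [MeasurableSpace Ω] (P : Measure Ω) {K : ℕ}
    (X : Fin K → Ω → SO3) (t : ℝ) (x : SO3) : ℝ :=
  ∫ ω, heatWaveletEstimator (fun k => X k ω) t x ∂P

/-- The bias term `‖f - E ζ‖²`. -/
def biasSq {Ω : Type*} [MeasurableSpace Ω] (P : Measure Ω) {K : ℕ}
    (X : Fin K → Ω → SO3) (f : SO3 → ℝ) (t : ℝ) : ℝ≥0∞ :=
  normSqSO3 (fun x => f x - meanEstimator P X t x)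

/-- The variance term `E ‖ζ - E ζ‖²`. -/
def varianceTerm {Ω : Type*} [MeasurableSpace Ω] (P : Measure Ω) {K : ℕ}
    (X : Fin K → Ω → SO3) (t : ℝ) : ℝ≥0∞ :=
  ∫⁻ ω, normSqSO3 (fun x => heatWaveletEstimator (fun k => X k ω) t x -
    meanEstimator P X t x) ∂P

/-- The mean integrated squared error `E ‖ζ - f‖²`. -/
def mise {Ω : Type*} [MeasurableSpace Ω] (P : Measure Ω) {K : ℕ}
    (X : Fin K → Ω → SO3) (f : SO3 → ℝ) (t : ℝ) : ℝ≥0∞ :=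
  ∫⁻ ω, normSqSO3 (fun x => heatWaveletEstimator (fun k => X k ω) t x - f x) ∂P

end

/-! The estimator is a heat kernel estimator in disguise. Convolution multiplies the coefficients of
character series and divides by `2ℓ+1`. Hence the wavelet autocorrelation at scale `ρ`, times
`α(ρ)`, has coefficient `(2ℓ+1) ℓ(ℓ+1) e^{-ℓ(ℓ+1)ρ}`, which is minus the `ρ`-derivative of the
coefficient of `κ_ρ`. Integrating over `ρ > t` returns every term of `κ_t` except `ℓ = 0`, and the
added constant `1` is that term (`heatWaveletEstimator_eq`).

For a kernel estimator from an independent sample, the mean at `x` is `f * κ_t` and the variance is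
`(f * κ_t² - (f * κ_t)²)/K`. Tonelli, together with `∫ f * κ_t² = ‖κ_t‖²`, gives the bias and
variance formulas (`lintegral_normSqSO3_kernelEstimator_sub`, `lintegral_variance_kernelEstimator`).
The series for the error is then Parseval applied to `f - f * κ_t`, `κ_t` and `f * κ_t`; the degree
zero term vanishes because `f` has mass one (`hasSum_pnat_bias_add_variance`).

Parseval is Peter–Weyl made explicit for functions given in Euler angles. The Wigner matrix is the
normalized symmetric power of order `2ℓ` of the `SU(2)` matrix of a unit quaternion over the
rotation; the even order removes the sign ambiguity, so a continuous unitary representation results.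
Schur orthogonality follows by testing intertwiners on rotations about the third axis and on one
rotation about the second axis. Completeness follows because the powers of `cos²(ω/2)` are
combinations of characters and, once normalized, form an approximate identity
(`FourierVanishes.integral_mul_continuous`).

The bound `f̂_ℓ² ≤ 1` is Jensen's inequality combined with unitarity. Since `∑ (2ℓ+1)² f̂_ℓ²`
converges and `∑ (2ℓ+1)²` does not, the limiting series is infinite; finite partial sums of the
variance series then force the error to infinity. -/

noncomputable section

/-! ### Symmetric powers of two by two matrices -/

/-- The matrix of the `N`-th symmetric power of `A`, in the basis of monomials. -/
def symPow (N : ℕ) (A : Matrix (Fin 2) (Fin 2) ℂ) : Matrix (Fin (N + 1)) (Fin (N + 1)) ℂ :=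
  Matrix.of fun i j =>
    ((Polynomial.C (A 0 0) * Polynomial.X + Polynomial.C (A 1 0)) ^ (j : ℕ) *
      (Polynomial.C (A 0 1) * Polynomial.X + Polynomial.C (A 1 1)) ^ (N - (j : ℕ))).coeff (i : ℕ)

/-- Identities between symmetric power matrices are proved by comparing generating polynomials; this
recovers the entries. -/
theorem eq_of_sum_mul_pow_eq {n : ℕ} {a b : Fin n → ℂ}
    (h : ∀ s : ℂ, ∑ i, a i * s ^ (i : ℕ) = ∑ i, b i * s ^ (i : ℕ)) : a = b := by
  have hp : (∑ i, Polynomial.C (a i) * Polynomial.X ^ (i : ℕ) : Polynomial ℂ) =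
      ∑ i, Polynomial.C (b i) * Polynomial.X ^ (i : ℕ) := by
    refine Polynomial.funext fun s => ?_
    simpa [Polynomial.eval_finsetSum] using h s
  funext k
  have := congrArg (fun p : Polynomial ℂ => p.coeff (k : ℕ)) hp
  simpa [Polynomial.finsetSum_coeff, Polynomial.coeff_C_mul, Polynomial.coeff_X_pow,
    Fin.val_inj] using this

/-- The bound ensures that the `N + 1` rows of `symPow` capture every coefficient of the polynomial
defining a column. -/
theorem natDegree_linear_pow_mul_le (a b c d : ℂ) {N j : ℕ} (hj : j ≤ N) :
    ((Polynomial.C a * Polynomial.X + Polynomial.C b) ^ j *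
      (Polynomial.C c * Polynomial.X + Polynomial.C d) ^ (N - j)).natDegree ≤ N := by
  refine Polynomial.natDegree_mul_le.trans ?_
  have h1 := Polynomial.natDegree_pow_le_of_le j (Polynomial.natDegree_linear_le (a := a) (b := b))
  have h2 := Polynomial.natDegree_pow_le_of_le (N - j)
    (Polynomial.natDegree_linear_le (a := c) (b := d))
  omega

theorem sum_symPow_one (N : ℕ) (A : Matrix (Fin 2) (Fin 2) ℂ) (j : Fin (N + 1)) (x : ℂ) :
    ∑ i, symPow N A i j * x ^ (i : ℕ) =
      (A 0 0 * x + A 1 0) ^ (j : ℕ) * (A 0 1 * x + A 1 1) ^ (N - (j : ℕ)) := by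
  have h := Polynomial.eval_eq_sum_range' (Nat.lt_succ_of_le
    (natDegree_linear_pow_mul_le (A 0 0) (A 1 0) (A 0 1) (A 1 1) (Nat.lt_succ_iff.1 j.2))) x
  rw [← Fin.sum_univ_eq_sum_range (fun i => _ * x ^ i)] at h
  simp only [symPow, Matrix.of_apply]
  rw [← h]
  simp

/-- Homogenization of `sum_symPow_one`: for `y ≠ 0` substitute `x / y` and multiply by `y ^ N`; the
value `y = 0` follows by continuity. -/
theorem sum_symPow (N : ℕ) (A : Matrix (Fin 2) (Fin 2) ℂ) (j : Fin (N + 1)) (x y : ℂ) :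
    ∑ i, symPow N A i j * (x ^ (i : ℕ) * y ^ (N - (i : ℕ))) =
      (A 0 0 * x + A 1 0 * y) ^ (j : ℕ) * (A 0 1 * x + A 1 1 * y) ^ (N - (j : ℕ)) := by
  have hd : Dense {y : ℂ | y ≠ 0} := dense_compl_singleton 0
  refine congrFun (Continuous.ext_on hd
    (f := fun y => ∑ i, symPow N A i j * (x ^ (i : ℕ) * y ^ (N - (i : ℕ))))
    (g := fun y => (A 0 0 * x + A 1 0 * y) ^ (j : ℕ) * (A 0 1 * x + A 1 1 * y) ^ (N - (j : ℕ)))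
    (by fun_prop) (by fun_prop) fun z hz => ?_) y
  have hz : z ≠ 0 := hz
  have h := congrArg (· * z ^ N) (sum_symPow_one N A j (x / z))
  simp only [Finset.sum_mul] at h
  have hN : z ^ N = z ^ (j : ℕ) * z ^ (N - (j : ℕ)) := by
    rw [← pow_add, Nat.add_sub_cancel' (Nat.lt_succ_iff.1 j.2)]
  have h2 : (A 0 0 * (x / z) + A 1 0) ^ (j : ℕ) * (A 0 1 * (x / z) + A 1 1) ^ (N - (j : ℕ)) * z ^ N
      = (A 0 0 * x + A 1 0 * z) ^ (j : ℕ) * (A 0 1 * x + A 1 1 * z) ^ (N - (j : ℕ)) := by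
    rw [hN, mul_mul_mul_comm, ← mul_pow, ← mul_pow]
    congr 2 <;> field_simp
  refine Eq.trans ?_ (h.trans h2)
  refine Finset.sum_congr rfl fun i _ => ?_
  have hi : z ^ N = z ^ (i : ℕ) * z ^ (N - (i : ℕ)) := by
    rw [← pow_add, Nat.add_sub_cancel' (Nat.lt_succ_iff.1 i.2)]
  rw [hi, div_pow]
  field_simp

/-- Symmetric powers are substitutions of linear forms: inserting the two forms of `A` into column
`j` for `B` gives column `j` for `A * B`. -/
theorem symPow_mul (N : ℕ) (A B : Matrix (Fin 2) (Fin 2) ℂ) :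
    symPow N (A * B) = symPow N A * symPow N B := by
  ext i j
  refine congrFun (eq_of_sum_mul_pow_eq (a := fun i => symPow N (A * B) i j)
    (b := fun i => (symPow N A * symPow N B) i j) fun s => ?_) i
  have h1 := sum_symPow N B j (A 0 0 * s + A 1 0) (A 0 1 * s + A 1 1)
  simp only [Matrix.mul_apply (M := symPow N A), sum_symPow_one, Matrix.mul_apply (M := A),
    Fin.sum_univ_two, Finset.sum_mul]
  rw [Finset.sum_comm]
  rw [show (A 0 0 * B 0 0 + A 0 1 * B 1 0) * s + (A 1 0 * B 0 0 + A 1 1 * B 1 0) =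
    B 0 0 * (A 0 0 * s + A 1 0) + B 1 0 * (A 0 1 * s + A 1 1) by ring,
    show (A 0 0 * B 0 1 + A 0 1 * B 1 1) * s + (A 1 0 * B 0 1 + A 1 1 * B 1 1) =
    B 0 1 * (A 0 0 * s + A 1 0) + B 1 1 * (A 0 1 * s + A 1 1) by ring, ← h1]
  refine Finset.sum_congr rfl fun k _ => ?_
  rw [← sum_symPow_one N A k s, Finset.mul_sum]
  exact Finset.sum_congr rfl fun l _ => by ring

theorem symPow_of_upper (N : ℕ) (A : Matrix (Fin 2) (Fin 2) ℂ) (hA : A 1 0 = 0)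
    (j : Fin (N + 1)) : symPow N A j j = A 0 0 ^ (j : ℕ) * A 1 1 ^ (N - (j : ℕ)) := by
  simp only [symPow, Matrix.of_apply, hA, map_zero, add_zero, mul_pow, ← map_pow]
  rw [mul_assoc, Polynomial.coeff_C_mul, Polynomial.coeff_X_pow_mul', if_pos le_rfl, Nat.sub_self,
    Polynomial.coeff_zero_eq_eval_zero]
  simp

theorem symPow_of_diagonal (N : ℕ) (A : Matrix (Fin 2) (Fin 2) ℂ) (hA : A 1 0 = 0)
    (hA' : A 0 1 = 0) :
    symPow N A = Matrix.diagonal fun j : Fin (N + 1) =>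
      A 0 0 ^ (j : ℕ) * A 1 1 ^ (N - (j : ℕ)) := by
  ext i j
  rcases eq_or_ne i j with rfl | hij
  · rw [symPow_of_upper N A hA, Matrix.diagonal_apply_eq]
  · rw [Matrix.diagonal_apply_ne _ hij]
    simp only [symPow, Matrix.of_apply, hA, hA', map_zero, add_zero, zero_mul, zero_add, mul_pow,
      ← map_pow]
    rw [mul_right_comm, ← map_mul, Polynomial.coeff_C_mul, Polynomial.coeff_X_pow,
      if_neg (fun h => hij (Fin.ext h)), mul_zero]

theorem symPow_one (N : ℕ) : symPow N 1 = 1 := by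
  rw [symPow_of_diagonal N 1 (by simp) (by simp)]
  simp

/-- The scalar `-1` acts by `(-1) ^ (2ℓ) = 1`. This parity lets the representation of `SU(2)`
descend to rotations. -/
theorem symPow_neg (ℓ : ℕ) (A : Matrix (Fin 2) (Fin 2) ℂ) :
    symPow (2 * ℓ) (-A) = symPow (2 * ℓ) A := by
  have h : symPow (2 * ℓ) (-1) = 1 := by
    refine (symPow_of_diagonal _ _ (by simp) (by simp)).trans (Eq.trans ?_ Matrix.diagonal_one)
    congr 1
    funext j
    simp only [Matrix.neg_apply, Matrix.one_apply_eq, ← pow_add]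
    rw [Nat.add_sub_cancel' (Nat.lt_succ_iff.1 j.2)]
    simp
  rw [← neg_one_mul A, symPow_mul, h, one_mul]

/-- The binomially weighted entries are the coefficients of `(A₀₀ st + A₁₀ t + A₀₁ s + A₁₁) ^ N`,
which is unchanged when `A` is transposed and `s`, `t` are exchanged. -/
theorem symPow_transpose (N : ℕ) (A : Matrix (Fin 2) (Fin 2) ℂ) (i j : Fin (N + 1)) :
    (N.choose j : ℂ) * symPow N A i j = N.choose i * symPow N A.transpose j i := by
  have key (B : Matrix (Fin 2) (Fin 2) ℂ) (s t : ℂ) :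
      ∑ j : Fin (N + 1), (∑ i : Fin (N + 1), (N.choose j : ℂ) * symPow N B i j * s ^ (i : ℕ)) *
        t ^ (j : ℕ) = (t * (B 0 0 * s + B 1 0) + (B 0 1 * s + B 1 1)) ^ N := by
    rw [add_pow, ← Fin.sum_univ_eq_sum_range
      (fun m => (t * (B 0 0 * s + B 1 0)) ^ m * (B 0 1 * s + B 1 1) ^ (N - m) * (N.choose m : ℂ))]
    refine Finset.sum_congr rfl fun j _ => ?_
    simp only [mul_assoc]
    rw [← Finset.mul_sum, sum_symPow_one, mul_pow]
    ring
  have h1 (s : ℂ) := eq_of_sum_mul_pow_eq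
    (a := fun j : Fin (N + 1) => ∑ i : Fin (N + 1), (N.choose j : ℂ) * symPow N A i j * s ^ (i : ℕ))
    (b := fun j : Fin (N + 1) =>
      ∑ i : Fin (N + 1), (N.choose i : ℂ) * symPow N A.transpose j i * s ^ (i : ℕ))
    fun t => by
      rw [key, show t * (A 0 0 * s + A 1 0) + (A 0 1 * s + A 1 1) =
        s * (A.transpose 0 0 * t + A.transpose 1 0) +
          (A.transpose 0 1 * t + A.transpose 1 1) by simp only [Matrix.transpose_apply]; ring,
        ← key]
      simp only [Finset.sum_mul]
      rw [Finset.sum_comm]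
      exact Finset.sum_congr rfl fun _ _ => Finset.sum_congr rfl fun _ _ => by ring
  exact congrFun (eq_of_sum_mul_pow_eq
    (a := fun i : Fin (N + 1) => (N.choose j : ℂ) * symPow N A i j)
    (b := fun i : Fin (N + 1) => (N.choose i : ℂ) * symPow N A.transpose j i)
    fun s => congrFun (h1 s) j) i

theorem symPow_map_star (N : ℕ) (A : Matrix (Fin 2) (Fin 2) ℂ) (i j : Fin (N + 1)) :
    symPow N (A.map (starRingEnd ℂ)) i j = starRingEnd ℂ (symPow N A i j) := by
  simp only [symPow, Matrix.of_apply, Matrix.map_apply]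
  rw [← Polynomial.coeff_map]
  simp

/-- Both sides satisfy the three-term Chebyshev recursion; `a * b = 1` supplies its last term. -/
theorem sum_pow_mul_pow_eq_chebyshev (a b : ℂ) (hab : a * b = 1) (N : ℕ) :
    ∑ j ∈ Finset.range (N + 1), a ^ j * b ^ (N - j) =
      (Polynomial.Chebyshev.U ℂ N).eval ((a + b) / 2) := by
  have hs (N : ℕ) : ∑ j ∈ Finset.range (N + 2), a ^ j * b ^ (N + 1 - j) =
      b * ∑ j ∈ Finset.range (N + 1), a ^ j * b ^ (N - j) + a ^ (N + 1) := by
    rw [Finset.sum_range_succ, Finset.mul_sum]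
    simp only [Nat.sub_self, pow_zero, mul_one]
    congr 1
    refine Finset.sum_congr rfl fun j hj => ?_
    rw [Nat.succ_sub (Nat.lt_succ_iff.1 (Finset.mem_range.1 hj)), pow_succ]
    ring
  induction N using Nat.twoStepInduction with
  | zero => simp
  | one => simp [Finset.sum_range_succ]; ring
  | more n h1 h2 =>
    rw [hs (n + 1), show ((n + 2 : ℕ) : ℤ) = (n : ℤ) + 2 by push_cast; ring,
      Polynomial.Chebyshev.U_add_two]
    simp only [Polynomial.eval_sub, Polynomial.eval_mul, Polynomial.eval_X, Polynomial.eval_ofNat]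
    rw [← h1, show ((n : ℤ) + 1) = ((n + 1 : ℕ) : ℤ) by push_cast; ring, ← h2, hs n]
    linear_combination (-∑ j ∈ Finset.range (n + 1), a ^ j * b ^ (n - j)) * hab

/-- An eigenvector `v` is the first column of `P`. The second column `(-v̄₁, v̄₀)` makes the
determinant `|v₀|² + |v₁|²`, which is nonzero. -/
theorem exists_mul_eq_mul_upper (A : Matrix (Fin 2) (Fin 2) ℂ) :
    ∃ P T : Matrix (Fin 2) (Fin 2) ℂ, IsUnit P ∧ T 1 0 = 0 ∧ A = P * T * P⁻¹ := by
  obtain ⟨μ, hμ⟩ := Module.End.exists_eigenvalue (Matrix.toLin' A)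
  obtain ⟨v, hv⟩ := hμ.exists_hasEigenvector
  have hv0 := hv.2
  have hAv : A.mulVec v = μ • v := by simpa using hv.apply_eq_smul
  have e0 := congrFun hAv 0
  have e1 := congrFun hAv 1
  simp [Matrix.mulVec, dotProduct, Fin.sum_univ_two] at e0 e1
  set P : Matrix (Fin 2) (Fin 2) ℂ := !![v 0, -starRingEnd ℂ (v 1); v 1, starRingEnd ℂ (v 0)]
  have hdet : P.det ≠ 0 := by
    simp only [P, Matrix.det_fin_two_of]
    rw [neg_mul, sub_neg_eq_add, mul_comm _ (v 1), Complex.mul_conj, Complex.mul_conj,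
      ← Complex.ofReal_add]
    intro h
    have h := Complex.ofReal_eq_zero.1 h
    have a0 := Complex.normSq_nonneg (v 0)
    have a1 := Complex.normSq_nonneg (v 1)
    refine hv0 (funext fun i => ?_)
    have b0 : Complex.normSq (v 0) = 0 := by linarith
    have b1 : Complex.normSq (v 1) = 0 := by linarith
    fin_cases i
    · exact Complex.normSq_eq_zero.1 b0
    · exact Complex.normSq_eq_zero.1 b1
  have hP : IsUnit P := (Matrix.isUnit_iff_isUnit_det _).2 hdet.isUnit
  refine ⟨P, P⁻¹ * A * P, hP, ?_, ?_⟩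
  · have hcol : (P⁻¹ * A * P) 1 0 = (P⁻¹.mulVec (A.mulVec v)) 1 := by
      have : P.col 0 = v := by funext i; fin_cases i <;> rfl
      rw [Matrix.mulVec_mulVec, ← this]
      rfl
    have hPv : P⁻¹.mulVec v = ![1, 0] := by
      have : v = P.mulVec ![1, 0] := by
        funext i; fin_cases i <;> simp [P, Matrix.mulVec, dotProduct, Fin.sum_univ_two]
      conv_lhs => rw [this]
      rw [Matrix.mulVec_mulVec, Matrix.nonsing_inv_mul _ hdet.isUnit, Matrix.one_mulVec]
    rw [hcol, hAv, Matrix.mulVec_smul, hPv]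
    simp
  · rw [← Matrix.mul_assoc, ← Matrix.mul_assoc, Matrix.mul_nonsing_inv _ hdet.isUnit,
      Matrix.one_mul, Matrix.mul_assoc, Matrix.mul_nonsing_inv _ hdet.isUnit, Matrix.mul_one]

/-- Conjugation reduces to a triangular matrix with diagonal entries `a`, `b`, `ab = 1`, whose
symmetric power has trace `∑ a^j b^(N-j)`. -/
theorem trace_symPow (N : ℕ) (A : Matrix (Fin 2) (Fin 2) ℂ) (hA : A.det = 1) :
    (symPow N A).trace = (Polynomial.Chebyshev.U ℂ N).eval (A.trace / 2) := by
  obtain ⟨P, T, hP, hT, rfl⟩ := exists_mul_eq_mul_upper A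
  have hPd := (Matrix.isUnit_iff_isUnit_det _).1 hP
  have hdet : T.det = 1 := by
    rw [Matrix.det_mul, mul_comm, ← Matrix.det_mul, ← Matrix.mul_assoc,
      Matrix.nonsing_inv_mul _ hPd, Matrix.one_mul] at hA
    exact hA
  rw [symPow_mul, Matrix.trace_mul_comm, symPow_mul, ← Matrix.mul_assoc, ← symPow_mul,
    Matrix.nonsing_inv_mul _ hPd, symPow_one, Matrix.one_mul, Matrix.trace_mul_comm (P * T),
    ← Matrix.mul_assoc, Matrix.nonsing_inv_mul _ hPd, Matrix.one_mul, Matrix.trace_fin_two T,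
    ← sum_pow_mul_pow_eq_chebyshev _ _ (by rw [Matrix.det_fin_two, hT] at hdet; simpa using hdet),
    ← Fin.sum_univ_eq_sum_range (fun j => T 0 0 ^ j * T 1 1 ^ (N - j))]
  exact Finset.sum_congr rfl fun j _ => by rw [Matrix.diag_apply, symPow_of_upper N T hT]

/-! ### Unitary normalization of the symmetric powers -/

/-- The normalization of the monomial of index `i` in the symmetric power. -/
def monomialWeight (N : ℕ) (i : Fin (N + 1)) : ℝ :=
  Real.sqrt ((i : ℕ).factorial * (N - (i : ℕ)).factorial)

theorem monomialWeight_pos (N : ℕ) (i : Fin (N + 1)) : 0 < monomialWeight N i :=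
  Real.sqrt_pos.2 (by positivity)

theorem monomialWeight_ne_zero (N : ℕ) (i : Fin (N + 1)) : (monomialWeight N i : ℂ) ≠ 0 :=
  Complex.ofReal_ne_zero.2 (monomialWeight_pos N i).ne'

theorem monomialWeight_sq (N : ℕ) (i : Fin (N + 1)) :
    (monomialWeight N i : ℂ) ^ 2 * N.choose i = N.factorial := by
  have h := Nat.choose_mul_factorial_mul_factorial (Nat.lt_succ_iff.1 i.2)
  rw [← Complex.ofReal_pow, monomialWeight, Real.sq_sqrt (by positivity), ← h]
  push_cast
  ring

/-- The symmetric power of `A` in the normalized basis of monomials. -/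
def unitarySymPow (N : ℕ) (A : Matrix (Fin 2) (Fin 2) ℂ) :
    Matrix (Fin (N + 1)) (Fin (N + 1)) ℂ :=
  Matrix.of fun i j => (monomialWeight N i : ℂ) * symPow N A i j * (monomialWeight N j : ℂ)⁻¹

theorem unitarySymPow_mul (N : ℕ) (A B : Matrix (Fin 2) (Fin 2) ℂ) :
    unitarySymPow N (A * B) = unitarySymPow N A * unitarySymPow N B := by
  ext i j
  simp only [unitarySymPow, Matrix.of_apply, Matrix.mul_apply (M := Matrix.of _), symPow_mul,
    Matrix.mul_apply (M := symPow N A), Finset.mul_sum, Finset.sum_mul]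
  refine Finset.sum_congr rfl fun k _ => ?_
  have := monomialWeight_ne_zero N k
  field_simp

theorem unitarySymPow_neg (ℓ : ℕ) (A : Matrix (Fin 2) (Fin 2) ℂ) :
    unitarySymPow (2 * ℓ) (-A) = unitarySymPow (2 * ℓ) A := by
  rw [unitarySymPow, symPow_neg, unitarySymPow]

theorem unitarySymPow_of_diagonal (N : ℕ) (A : Matrix (Fin 2) (Fin 2) ℂ) (hA : A 1 0 = 0)
    (hA' : A 0 1 = 0) :
    unitarySymPow N A = Matrix.diagonal fun j : Fin (N + 1) =>
      A 0 0 ^ (j : ℕ) * A 1 1 ^ (N - (j : ℕ)) := by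
  ext i j
  rw [unitarySymPow, Matrix.of_apply, symPow_of_diagonal N A hA hA']
  rcases eq_or_ne i j with rfl | hij
  · rw [Matrix.diagonal_apply_eq, mul_right_comm, mul_inv_cancel₀ (monomialWeight_ne_zero N i),
      one_mul]
  · rw [Matrix.diagonal_apply_ne _ hij]; ring

theorem unitarySymPow_one (N : ℕ) : unitarySymPow N 1 = 1 := by
  rw [unitarySymPow_of_diagonal N 1 (by simp) (by simp)]
  simp

theorem trace_unitarySymPow (N : ℕ) (A : Matrix (Fin 2) (Fin 2) ℂ) (hA : A.det = 1) :
    (unitarySymPow N A).trace = (Polynomial.Chebyshev.U ℂ N).eval (A.trace / 2) := by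
  rw [← trace_symPow N A hA]
  refine Finset.sum_congr rfl fun i _ => ?_
  rw [Matrix.diag_apply, Matrix.diag_apply, unitarySymPow, Matrix.of_apply, mul_right_comm,
    mul_inv_cancel₀ (monomialWeight_ne_zero N i), one_mul]

/-- The weights satisfy `w_i² * N.choose i = N!`, so they absorb exactly the binomials of
`symPow_transpose`. Unitary matrices therefore have unitary symmetric powers. -/
theorem unitarySymPow_conjTranspose (N : ℕ) (A : Matrix (Fin 2) (Fin 2) ℂ) :
    unitarySymPow N A.conjTranspose = (unitarySymPow N A).conjTranspose := by
  ext i j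
  have h1 := symPow_transpose N (A.map (starRingEnd ℂ)) j i
  have h2 : (A.map (starRingEnd ℂ)).transpose = A.conjTranspose := rfl
  rw [symPow_map_star, h2] at h1
  have wi := monomialWeight_ne_zero N i
  have wj := monomialWeight_ne_zero N j
  have ci := monomialWeight_sq N i
  have cj := monomialWeight_sq N j
  have hN : (N.factorial : ℂ) ≠ 0 := Nat.cast_ne_zero.2 N.factorial_ne_zero
  simp only [unitarySymPow, Matrix.of_apply, Matrix.conjTranspose_apply, 
    ← starRingEnd_apply, map_mul, map_inv₀, Complex.conj_ofReal]
  field_simp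
  refine mul_left_cancel₀ hN ?_
  linear_combination
    (starRingEnd ℂ (symPow N A j i)) * (monomialWeight N j : ℂ) ^ 2 * ci -
    (monomialWeight N i : ℂ) ^ 2 * symPow N A.conjTranspose i j * cj -
    (monomialWeight N i : ℂ) ^ 2 * (monomialWeight N j : ℂ) ^ 2 * h1

theorem continuous_unitarySymPow (N : ℕ) (i j : Fin (N + 1)) :
    Continuous fun A => unitarySymPow N A i j := by
  have h : Continuous fun A => symPow N A i j := by
    simp only [symPow, Matrix.of_apply, Polynomial.coeff_mul]
    refine continuous_finsetSum _ fun p _ => ?_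
    have aux (k n : ℕ) (u v : Fin 2 × Fin 2) : Continuous fun A : Matrix (Fin 2) (Fin 2) ℂ =>
        ((Polynomial.C (A u.1 u.2) * Polynomial.X + Polynomial.C (A v.1 v.2)) ^ n).coeff k := by
      simp only [add_pow, mul_pow, ← map_pow, Polynomial.finsetSum_coeff]
      refine continuous_finsetSum _ fun m _ => ?_
      simp only [← Polynomial.C_eq_natCast, Polynomial.coeff_mul_C, Polynomial.coeff_C_mul]
      fun_prop
    exact (aux _ _ (0, 0) (1, 0)).mul (aux _ _ (0, 1) (1, 1))
  simp only [unitarySymPow, Matrix.of_apply]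
  exact (continuous_const.mul h).mul continuous_const

end

noncomputable section

/-! ### Unit quaternions and rotations -/

open Quaternion in
/-- The complex two by two matrix of a quaternion. -/
def quatMatrix (q : ℍ[ℝ]) : Matrix (Fin 2) (Fin 2) ℂ :=
  !![⟨q.re, -q.imK⟩, ⟨-q.imJ, -q.imI⟩; ⟨q.imJ, -q.imI⟩, ⟨q.re, q.imK⟩]

open Quaternion in
/-- The matrix of `v ↦ q v q⁎` on imaginary quaternions. -/
def quatRotation (q : ℍ[ℝ]) : Matrix (Fin 3) (Fin 3) ℝ :=
  !![q.re ^ 2 + q.imI ^ 2 - q.imJ ^ 2 - q.imK ^ 2, 2 * (q.imI * q.imJ - q.re * q.imK),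
      2 * (q.imI * q.imK + q.re * q.imJ);
    2 * (q.imI * q.imJ + q.re * q.imK), q.re ^ 2 - q.imI ^ 2 + q.imJ ^ 2 - q.imK ^ 2,
      2 * (q.imJ * q.imK - q.re * q.imI);
    2 * (q.imI * q.imK - q.re * q.imJ), 2 * (q.imJ * q.imK + q.re * q.imI),
      q.re ^ 2 - q.imI ^ 2 - q.imJ ^ 2 + q.imK ^ 2]

open Quaternion

theorem quatMatrix_mul (p q : ℍ[ℝ]) : quatMatrix (p * q) = quatMatrix p * quatMatrix q := by
  ext i j
  fin_cases i <;> fin_cases j <;>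
    simp [quatMatrix, Matrix.mul_apply, Fin.sum_univ_two, Complex.ext_iff] <;>
    constructor <;> ring

theorem quatMatrix_neg (q : ℍ[ℝ]) : quatMatrix (-q) = -quatMatrix q := by
  ext i j
  fin_cases i <;> fin_cases j <;> simp [quatMatrix, Complex.ext_iff]

theorem quatMatrix_star (q : ℍ[ℝ]) : quatMatrix (star q) = (quatMatrix q).conjTranspose := by
  ext i j
  fin_cases i <;> fin_cases j <;> simp [quatMatrix, Complex.ext_iff]

theorem quatMatrix_det (q : ℍ[ℝ]) : (quatMatrix q).det = normSq q := by
  rw [Quaternion.normSq_def', quatMatrix, Matrix.det_fin_two_of]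
  refine Complex.ext ?_ ?_
  · simp only [Complex.sub_re, Complex.mul_re, Complex.ofReal_re]
    ring
  · simp only [Complex.sub_im, Complex.mul_im, Complex.ofReal_im]
    ring

theorem quatMatrix_trace (q : ℍ[ℝ]) : (quatMatrix q).trace = 2 * q.re := by
  simp [quatMatrix, Matrix.trace_fin_two_of, Complex.ext_iff]
  ring

theorem quatRotation_mul (p q : ℍ[ℝ]) :
    quatRotation (p * q) = quatRotation p * quatRotation q := by
  ext i j
  fin_cases i <;> fin_cases j <;>
    simp [quatRotation, Matrix.mul_apply, Fin.sum_univ_three] <;> ring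

theorem quatRotation_star (q : ℍ[ℝ]) : quatRotation (star q) = (quatRotation q).transpose := by
  ext i j
  fin_cases i <;> fin_cases j <;> simp [quatRotation] <;> ring

theorem quatRotation_trace (q : ℍ[ℝ]) (hq : normSq q = 1) :
    (quatRotation q).trace = 4 * q.re ^ 2 - 1 := by
  rw [Quaternion.normSq_def'] at hq
  simp [quatRotation, Matrix.trace_fin_three]
  linear_combination -hq

theorem quatRotation_one : quatRotation 1 = 1 := by
  ext i j
  fin_cases i <;> fin_cases j <;> simp [quatRotation]

theorem quatRotation_mem (q : ℍ[ℝ]) (hq : normSq q = 1) :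
    quatRotation q ∈ Matrix.specialOrthogonalGroup (Fin 3) ℝ := by
  have h1 : quatRotation q * (quatRotation q).transpose = 1 := by
    rw [← quatRotation_star, ← quatRotation_mul, Quaternion.self_mul_star, hq,
      Quaternion.coe_one, quatRotation_one]
  refine ⟨(Matrix.mem_orthogonalGroup_iff (Fin 3) ℝ).2 h1, ?_⟩
  have : (quatRotation q).det = (normSq q) ^ 3 := by
    simp [quatRotation, Matrix.det_fin_three, Quaternion.normSq_def']
    ring
  exact MonoidHom.mem_mker.2 (this.trans (by rw [hq, one_pow]))

/-- With unit norms, the nine entries determine all products of two coordinates, so `p pᵀ = q qᵀ` as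
vectors of `ℝ⁴`. Applying this to `p` gives `p = t q` with `t = ⟨p, q⟩`, and the norms give `t² =
1`. -/
theorem eq_or_eq_neg_of_quatRotation_eq {p q : ℍ[ℝ]} (hp : normSq p = 1) (hq : normSq q = 1)
    (h : quatRotation p = quatRotation q) : p = q ∨ p = -q := by
  have e (i j : Fin 3) := congrFun (congrFun h i) j
  have e00 := e 0 0
  have e01 := e 0 1
  have e02 := e 0 2
  have e10 := e 1 0
  have e11 := e 1 1
  have e12 := e 1 2
  have e20 := e 2 0
  have e21 := e 2 1
  have e22 := e 2 2
  simp [quatRotation] at e00 e01 e02 e10 e11 e12 e20 e21 e22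
  rw [Quaternion.normSq_def'] at hp hq
  set t := p.re * q.re + p.imI * q.imI + p.imJ * q.imJ + p.imK * q.imK with ht
  have aa : p.re * p.re = q.re * q.re := by linarith
  have bb : p.imI * p.imI = q.imI * q.imI := by linarith
  have cc : p.imJ * p.imJ = q.imJ * q.imJ := by linarith
  have dd : p.imK * p.imK = q.imK * q.imK := by linarith
  have ab : p.re * p.imI = q.re * q.imI := by linarith
  have ac : p.re * p.imJ = q.re * q.imJ := by linarith
  have ad : p.re * p.imK = q.re * q.imK := by linarith
  have bc : p.imI * p.imJ = q.imI * q.imJ := by linarith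
  have bd : p.imI * p.imK = q.imI * q.imK := by linarith
  have cd : p.imJ * p.imK = q.imJ * q.imK := by linarith
  have r1 : p.re = t * q.re := by
    have : t * q.re = p.re * (p.re * p.re) + p.imI * (p.re * p.imI) + p.imJ * (p.re * p.imJ) +
      p.imK * (p.re * p.imK) := by rw [aa, ab, ac, ad, ht]; ring
    linear_combination -this - p.re * hp
  have r2 : p.imI = t * q.imI := by
    have : t * q.imI = p.re * (p.re * p.imI) + p.imI * (p.imI * p.imI) + p.imJ * (p.imI * p.imJ) +
      p.imK * (p.imI * p.imK) := by rw [ab, bb, bc, bd, ht]; ring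
    linear_combination -this - p.imI * hp
  have r3 : p.imJ = t * q.imJ := by
    have : t * q.imJ = p.re * (p.re * p.imJ) + p.imI * (p.imI * p.imJ) + p.imJ * (p.imJ * p.imJ) +
      p.imK * (p.imJ * p.imK) := by rw [ac, bc, cc, cd, ht]; ring
    linear_combination -this - p.imJ * hp
  have r4 : p.imK = t * q.imK := by
    have : t * q.imK = p.re * (p.re * p.imK) + p.imI * (p.imI * p.imK) + p.imJ * (p.imJ * p.imK) +
      p.imK * (p.imK * p.imK) := by rw [ad, bd, cd, dd, ht]; ring
    linear_combination -this - p.imK * hp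
  have ht2 : t * t = 1 := by
    rw [r1, r2, r3, r4] at hp
    linear_combination hp - t * t * hq
  rcases mul_self_eq_one_iff.1 ht2 with h1 | h1 <;> rw [h1] at r1 r2 r3 r4
  · left; ext <;> linarith
  · right; ext <;> simp <;> linarith

/-- The unit quaternion of a rotation about the third axis. -/
def quatZ (a : ℝ) : ℍ[ℝ] := ⟨Real.cos (a / 2), 0, 0, Real.sin (a / 2)⟩

/-- The unit quaternion of a rotation about the second axis. -/
def quatY (a : ℝ) : ℍ[ℝ] := ⟨Real.cos (a / 2), 0, Real.sin (a / 2), 0⟩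

theorem quatRotation_quatZ (a : ℝ) : quatRotation (quatZ a) = rotZ a := by
  have h1 := Real.cos_sq_add_sin_sq (a / 2)
  have h2 : Real.cos a = Real.cos (a / 2) ^ 2 - Real.sin (a / 2) ^ 2 := by
    rw [← Real.cos_two_mul']; ring_nf
  have h3 : Real.sin a = 2 * Real.sin (a / 2) * Real.cos (a / 2) := by
    rw [← Real.sin_two_mul]; ring_nf
  ext i j
  fin_cases i <;> fin_cases j <;> simp [quatRotation, rotZ, quatZ, h2, h3] <;> linarith

theorem quatRotation_quatY (a : ℝ) : quatRotation (quatY a) = rotY a := by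
  have h1 := Real.cos_sq_add_sin_sq (a / 2)
  have h2 : Real.cos a = Real.cos (a / 2) ^ 2 - Real.sin (a / 2) ^ 2 := by
    rw [← Real.cos_two_mul']; ring_nf
  have h3 : Real.sin a = 2 * Real.sin (a / 2) * Real.cos (a / 2) := by
    rw [← Real.sin_two_mul]; ring_nf
  ext i j
  fin_cases i <;> fin_cases j <;> simp [quatRotation, rotY, quatY, h2, h3] <;> linarith

theorem normSq_quatZ (a : ℝ) : normSq (quatZ a) = 1 := by
  rw [Quaternion.normSq_def']; simp [quatZ]

theorem normSq_quatY (a : ℝ) : normSq (quatY a) = 1 := by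
  rw [Quaternion.normSq_def']; simp [quatY]

/-- The diagonal entries of the matrix are `e^{∓ia/2}`, so index `j` carries `e^{-ija/2}
e^{i(2ℓ-j)a/2} = e^{-i(j-ℓ)a}`, the outer factor of a Wigner function. -/
theorem unitarySymPow_quatZ (ℓ : ℕ) (a : ℝ) :
    unitarySymPow (2 * ℓ) (quatMatrix (quatZ a)) = Matrix.diagonal fun j : Fin (2 * ℓ + 1) =>
      Complex.exp (-Complex.I * (((j : ℕ) : ℂ) - (ℓ : ℂ)) * (a : ℂ)) := by
  rw [unitarySymPow_of_diagonal _ _ (by simp [quatMatrix, quatZ, Complex.ext_iff])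
    (by simp [quatMatrix, quatZ, Complex.ext_iff])]
  congr 1
  funext j
  have h0 : quatMatrix (quatZ a) 0 0 = Complex.exp (-(a / 2 : ℝ) * Complex.I) := by
    rw [← Complex.ofReal_neg]
    refine Complex.ext ?_ ?_
    · rw [Complex.exp_ofReal_mul_I_re]; simp [quatMatrix, quatZ]
    · rw [Complex.exp_ofReal_mul_I_im]; simp [quatMatrix, quatZ]
  have h1 : quatMatrix (quatZ a) 1 1 = Complex.exp ((a / 2 : ℝ) * Complex.I) := by
    refine Complex.ext ?_ ?_
    · rw [Complex.exp_ofReal_mul_I_re]; simp [quatMatrix, quatZ]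
    · rw [Complex.exp_ofReal_mul_I_im]; simp [quatMatrix, quatZ]
  rw [h0, h1, ← Complex.exp_nat_mul, ← Complex.exp_nat_mul, ← Complex.exp_add,
    Nat.cast_sub (Nat.lt_succ_iff.1 j.2)]
  congr 1
  push_cast
  ring

theorem unitarySymPow_quatY (ℓ : ℕ) (a : ℝ) (i j : Fin (2 * ℓ + 1)) :
    unitarySymPow (2 * ℓ) (quatMatrix (quatY a)) i j = wignerSmallD ℓ i j a := by
  have hm : quatMatrix (quatY a) = !![(Real.cos (a / 2) : ℂ), ((-Real.sin (a / 2) : ℝ) : ℂ);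
      (Real.sin (a / 2) : ℂ), (Real.cos (a / 2) : ℂ)] := by
    ext i j
    fin_cases i <;> fin_cases j <;> simp [quatMatrix, quatY, Complex.ext_iff,
      -Complex.ofReal_cos, -Complex.ofReal_sin]
  have hp : ((Polynomial.C (Real.cos (a / 2) : ℂ) * Polynomial.X +
      Polynomial.C (Real.sin (a / 2) : ℂ)) ^ (j : ℕ) *
      (Polynomial.C ((-Real.sin (a / 2) : ℝ) : ℂ) * Polynomial.X +
        Polynomial.C (Real.cos (a / 2) : ℂ)) ^ (2 * ℓ - (j : ℕ))) =
      ((Polynomial.C (Real.cos (a / 2)) * Polynomial.X +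
        Polynomial.C (Real.sin (a / 2))) ^ (j : ℕ) *
      (Polynomial.C (-Real.sin (a / 2)) * Polynomial.X +
        Polynomial.C (Real.cos (a / 2))) ^ (2 * ℓ - (j : ℕ))).map (algebraMap ℝ ℂ) := by
    simp only [Polynomial.map_mul, Polynomial.map_pow, Polynomial.map_add, Polynomial.map_C,
      Polynomial.map_X, Complex.coe_algebraMap]
  rw [unitarySymPow, Matrix.of_apply, symPow, Matrix.of_apply, hm]
  simp only [Matrix.of_apply, Matrix.cons_val', Matrix.cons_val_zero, Matrix.cons_val_one,
    Matrix.cons_val_fin_one]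
  rw [hp, Polynomial.coeff_map, Complex.coe_algebraMap, ← Complex.ofReal_mul,
    ← Complex.ofReal_inv, ← Complex.ofReal_mul, wignerSmallD, Real.sqrt_div (by positivity)]
  simp only [monomialWeight]
  congr 1
  ring

/-- A unit quaternion representing a rotation, given by its Euler angles. -/
def quatLift (x : SO3) : ℍ[ℝ] :=
  quatZ (eulerZYZ x).1 * quatY (eulerZYZ x).2.1 * quatZ (eulerZYZ x).2.2

theorem normSq_quatLift (x : SO3) : normSq (quatLift x) = 1 := by
  rw [quatLift, map_mul, map_mul, normSq_quatZ, normSq_quatZ, normSq_quatY]; norm_num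

theorem quatRotation_quatLift (x : SO3) : quatRotation (quatLift x) = x.1 := by
  rw [quatLift, quatRotation_mul, quatRotation_mul, quatRotation_quatZ, quatRotation_quatZ,
    quatRotation_quatY]
  exact (eulerZYZ_spec x).2.2.2.symm

/-! ### The Wigner matrices form a unitary representation -/

/-- The matrix of Wigner functions of degree `ℓ`. -/
def wignerMatrix (ℓ : ℕ) (x : SO3) : Matrix (Fin (2 * ℓ + 1)) (Fin (2 * ℓ + 1)) ℂ :=
  Matrix.of fun i j => wignerD ℓ i j x

theorem wignerMatrix_apply (ℓ : ℕ) (x : SO3) (i j : Fin (2 * ℓ + 1)) :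
    wignerMatrix ℓ x i j = wignerD ℓ i j x := rfl

theorem wignerMatrix_eq (ℓ : ℕ) (x : SO3) :
    wignerMatrix ℓ x = unitarySymPow (2 * ℓ) (quatMatrix (quatLift x)) := by
  ext i j
  rw [quatLift, quatMatrix_mul, quatMatrix_mul, unitarySymPow_mul, unitarySymPow_mul,
    unitarySymPow_quatZ, unitarySymPow_quatZ, Matrix.mul_diagonal, Matrix.diagonal_mul,
    unitarySymPow_quatY]
  rfl

/-- Any unit quaternion over `x` may replace the one built from Euler angles, as the two differ by a
sign. Multiplicativity, inverses and continuity all rest on this freedom. -/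
theorem wignerMatrix_eq_of_quatRotation (ℓ : ℕ) {x : SO3} {q : ℍ[ℝ]} (hq : normSq q = 1)
    (h : quatRotation q = x.1) : wignerMatrix ℓ x = unitarySymPow (2 * ℓ) (quatMatrix q) := by
  rw [wignerMatrix_eq]
  rcases eq_or_eq_neg_of_quatRotation_eq (normSq_quatLift x) hq
    ((quatRotation_quatLift x).trans h.symm) with h | h
  · rw [h]
  · rw [h, quatMatrix_neg, unitarySymPow_neg]

theorem wignerMatrix_mul (ℓ : ℕ) (x y : SO3) :
    wignerMatrix ℓ (x * y) = wignerMatrix ℓ x * wignerMatrix ℓ y := by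
  rw [wignerMatrix_eq_of_quatRotation ℓ (q := quatLift x * quatLift y), quatMatrix_mul,
    unitarySymPow_mul, wignerMatrix_eq, wignerMatrix_eq]
  · rw [map_mul, normSq_quatLift, normSq_quatLift, one_mul]
  · rw [quatRotation_mul, quatRotation_quatLift, quatRotation_quatLift]; rfl

theorem wignerMatrix_inv (ℓ : ℕ) (x : SO3) :
    wignerMatrix ℓ x⁻¹ = (wignerMatrix ℓ x).conjTranspose := by
  rw [wignerMatrix_eq_of_quatRotation ℓ (q := star (quatLift x)), quatMatrix_star,
    unitarySymPow_conjTranspose, wignerMatrix_eq]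
  · rw [Quaternion.normSq_star, normSq_quatLift]
  · rw [quatRotation_star, quatRotation_quatLift, SO3.coe_inv]

theorem wignerMatrix_one (ℓ : ℕ) : wignerMatrix ℓ 1 = 1 := by
  rw [wignerMatrix_eq_of_quatRotation ℓ (q := 1) (by simp) quatRotation_one,
    ← unitarySymPow_one (2 * ℓ)]
  congr 1
  ext i j
  fin_cases i <;> fin_cases j <;> simp [quatMatrix, Complex.ext_iff]

theorem wignerMatrix_mul_conjTranspose (ℓ : ℕ) (x : SO3) :
    wignerMatrix ℓ x * (wignerMatrix ℓ x).conjTranspose = 1 := by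
  rw [← wignerMatrix_inv, ← wignerMatrix_mul, mul_inv_cancel, wignerMatrix_one]

theorem sum_norm_sq_wignerD (ℓ : ℕ) (x : SO3) (i : Fin (2 * ℓ + 1)) :
    ∑ j, ‖wignerD ℓ i j x‖ ^ 2 = 1 := by
  have h := congrFun (congrFun (wignerMatrix_mul_conjTranspose ℓ x) i) i
  simp only [Matrix.mul_apply, Matrix.conjTranspose_apply, Matrix.one_apply_eq,
    wignerMatrix_apply, ← starRingEnd_apply, Complex.mul_conj, Complex.normSq_eq_norm_sq] at h
  exact_mod_cast h

theorem norm_wignerD_le_one (ℓ : ℕ) (i j : Fin (2 * ℓ + 1)) (x : SO3) :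
    ‖wignerD ℓ i j x‖ ≤ 1 := by
  rw [← sq_le_one_iff₀ (norm_nonneg _), ← sum_norm_sq_wignerD ℓ x i]
  exact Finset.single_le_sum (f := fun j => ‖wignerD ℓ i j x‖ ^ 2)
    (fun _ _ => sq_nonneg _) (Finset.mem_univ j)

/-! ### Continuity of the Wigner functions through the double cover -/

/-- The covering map from unit quaternions to rotations. -/
def quatCover (q : Metric.sphere (0 : ℍ[ℝ]) 1) : SO3 :=
  ⟨quatRotation q.1, quatRotation_mem q.1 (by
    rw [Quaternion.normSq_eq_norm_mul_self, mem_sphere_zero_iff_norm.1 q.2, one_mul])⟩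

/-- A continuous surjection from the compact sphere to a Hausdorff space is closed, hence a quotient
map. Continuity can then be tested on quaternions, which avoids the discontinuous choice of Euler
angles. -/
theorem isQuotientMap_quatCover : IsQuotientMap quatCover := by
  have hc : Continuous quatCover := by
    refine Continuous.subtype_mk ?_ _
    refine continuous_matrix fun i j => ?_
    have hr : Continuous fun q : Metric.sphere (0 : ℍ[ℝ]) 1 => q.1.re :=
      Quaternion.continuous_re.comp continuous_subtype_val
    have hi : Continuous fun q : Metric.sphere (0 : ℍ[ℝ]) 1 => q.1.imI :=
      Quaternion.continuous_imI.comp continuous_subtype_val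
    have hj : Continuous fun q : Metric.sphere (0 : ℍ[ℝ]) 1 => q.1.imJ :=
      Quaternion.continuous_imJ.comp continuous_subtype_val
    have hk : Continuous fun q : Metric.sphere (0 : ℍ[ℝ]) 1 => q.1.imK :=
      Quaternion.continuous_imK.comp continuous_subtype_val
    fin_cases i <;> fin_cases j <;> simp [quatRotation] <;> fun_prop
  have : ProperSpace ℍ[ℝ] := FiniteDimensional.proper ℝ _
  refine hc.isClosedMap.isQuotientMap hc fun x => ⟨⟨quatLift x, ?_⟩, ?_⟩
  · rw [mem_sphere_zero_iff_norm, ← sq_eq_sq₀ (norm_nonneg _) zero_le_one, one_pow, sq,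
      ← Quaternion.normSq_eq_norm_mul_self, normSq_quatLift]
  · exact Subtype.ext (quatRotation_quatLift x)

theorem continuous_wignerD (ℓ : ℕ) (i j : Fin (2 * ℓ + 1)) : Continuous (wignerD ℓ i j) := by
  rw [isQuotientMap_quatCover.continuous_iff]
  have h : wignerD ℓ i j ∘ quatCover = fun q => unitarySymPow (2 * ℓ) (quatMatrix q.1) i j := by
    funext q
    rw [← wignerMatrix_eq_of_quatRotation ℓ (x := quatCover q) _ rfl]
    · rfl
    · rw [Quaternion.normSq_eq_norm_mul_self, mem_sphere_zero_iff_norm.1 q.2, one_mul]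
  rw [h]
  refine (continuous_unitarySymPow (2 * ℓ) i j).comp (continuous_matrix fun a b => ?_)
  have hr : Continuous fun q : Metric.sphere (0 : ℍ[ℝ]) 1 => (q.1.re : ℂ) :=
    Complex.continuous_ofReal.comp (Quaternion.continuous_re.comp continuous_subtype_val)
  have hi : Continuous fun q : Metric.sphere (0 : ℍ[ℝ]) 1 => (q.1.imI : ℂ) :=
    Complex.continuous_ofReal.comp (Quaternion.continuous_imI.comp continuous_subtype_val)
  have hj : Continuous fun q : Metric.sphere (0 : ℍ[ℝ]) 1 => (q.1.imJ : ℂ) :=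
    Complex.continuous_ofReal.comp (Quaternion.continuous_imJ.comp continuous_subtype_val)
  have hk : Continuous fun q : Metric.sphere (0 : ℍ[ℝ]) 1 => (q.1.imK : ℂ) :=
    Complex.continuous_ofReal.comp (Quaternion.continuous_imK.comp continuous_subtype_val)
  fin_cases a <;> fin_cases b <;> simp [quatMatrix, Complex.mk_eq_add_mul_I] <;> fun_prop

/-! ### Characters -/

theorem quatLift_re_sq (x : SO3) : (quatLift x).re ^ 2 = (1 + x.1.trace) / 4 := by
  rw [← quatRotation_quatLift x, quatRotation_trace _ (normSq_quatLift x)]; ring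

theorem quatLift_re_sq_le_one (x : SO3) : (quatLift x).re ^ 2 ≤ 1 := by
  have h := normSq_quatLift x
  rw [Quaternion.normSq_def'] at h
  nlinarith [sq_nonneg (quatLift x).imI, sq_nonneg (quatLift x).imJ, sq_nonneg (quatLift x).imK]

theorem cos_half_rotAngle_sq (x : SO3) :
    Real.cos (rotAngle x / 2) ^ 2 = (1 + x.1.trace) / 4 := by
  have h1 := quatLift_re_sq x
  have h2 := quatLift_re_sq_le_one x
  have h3 := sq_nonneg (quatLift x).re
  rw [Real.cos_sq, mul_div_cancel₀ _ two_ne_zero, rotAngle,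
    Real.cos_arccos (by linarith) (by linarith)]
  ring

theorem chebyshev_U_even_eval_neg (ℓ : ℕ) (u : ℝ) :
    (Polynomial.Chebyshev.U ℝ (2 * (ℓ : ℤ))).eval (-u) =
      (Polynomial.Chebyshev.U ℝ (2 * (ℓ : ℤ))).eval u := by
  have h := Polynomial.Chebyshev.U_eval_neg (R := ℝ) (2 * ℓ) u
  simpa using h

/-- The real part of the quaternion is `cos (ω/2)` only up to sign, which does not matter since
`U_{2ℓ}` is even. -/
theorem charSO3_eq_eval_quatLift (ℓ : ℕ) (x : SO3) :
    charSO3 ℓ x = (Polynomial.Chebyshev.U ℝ (2 * (ℓ : ℤ))).eval (quatLift x).re := by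
  rw [charSO3]
  rcases sq_eq_sq_iff_eq_or_eq_neg.1
    ((cos_half_rotAngle_sq x).trans (quatLift_re_sq x).symm) with h | h
  · rw [h]
  · rw [h, chebyshev_U_even_eval_neg]

theorem trace_wignerMatrix (ℓ : ℕ) (x : SO3) : (wignerMatrix ℓ x).trace = charSO3 ℓ x := by
  rw [wignerMatrix_eq, trace_unitarySymPow _ _ (by rw [quatMatrix_det, normSq_quatLift]; simp),
    quatMatrix_trace, mul_div_cancel_left₀ _ two_ne_zero, charSO3_eq_eval_quatLift,
    ← Polynomial.Chebyshev.complex_ofReal_eval_U]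
  push_cast
  rfl

theorem charSO3_eq_sum (ℓ : ℕ) (x : SO3) : (charSO3 ℓ x : ℂ) = ∑ i, wignerD ℓ i i x :=
  (trace_wignerMatrix ℓ x).symm

/-- Addition formula: the trace of `D(y)ᴴ D(x)`. It turns convolution with a character into Fourier
coefficients. -/
theorem charSO3_inv_mul (ℓ : ℕ) (y x : SO3) :
    (charSO3 ℓ (y⁻¹ * x) : ℂ) =
      ∑ i, ∑ j, starRingEnd ℂ (wignerD ℓ i j y) * wignerD ℓ i j x := by
  rw [← trace_wignerMatrix, wignerMatrix_mul, wignerMatrix_inv, Finset.sum_comm]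
  simp only [Matrix.trace, Matrix.diag_apply, Matrix.mul_apply, Matrix.conjTranspose_apply,
    wignerMatrix_apply, starRingEnd_apply]

theorem continuous_charSO3 (ℓ : ℕ) : Continuous (charSO3 ℓ) := by
  have h : Continuous fun x => (charSO3 ℓ x : ℂ) := by
    simp only [charSO3_eq_sum]
    exact continuous_finsetSum _ fun i _ => continuous_wignerD ℓ i i
  exact Complex.continuous_re.comp h

theorem abs_charSO3_le (ℓ : ℕ) (x : SO3) : |charSO3 ℓ x| ≤ 2 * ℓ + 1 := by
  rw [← Real.norm_eq_abs, ← Complex.norm_real, charSO3_eq_sum]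
  refine (norm_sum_le_of_le _ fun i _ => norm_wignerD_le_one ℓ i i x).trans ?_
  simp

theorem charSO3_inv (ℓ : ℕ) (x : SO3) : charSO3 ℓ x⁻¹ = charSO3 ℓ x := by
  have h : x⁻¹.1.trace = x.1.trace := by rw [SO3.coe_inv, Matrix.trace_transpose]
  rw [charSO3, charSO3, rotAngle, rotAngle, h]

theorem charSO3_zero (x : SO3) : charSO3 0 x = 1 := by simp [charSO3]

end

noncomputable section

/-! ### Haar measure -/

instance : Measure.IsHaarMeasure SO3.haar := by unfold SO3.haar; infer_instance

instance : Measure.Regular SO3.haar := by unfold SO3.haar; infer_instance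

instance : IsProbabilityMeasure SO3.haar :=
  ⟨by
    have h := Measure.haarMeasure_self (K₀ := (⊤ : TopologicalSpace.PositiveCompacts SO3))
    rwa [TopologicalSpace.PositiveCompacts.coe_top] at h⟩

instance : SecondCountableTopology SO3 := by
  have : SecondCountableTopology (Matrix (Fin 3) (Fin 3) ℝ) :=
    inferInstanceAs (SecondCountableTopology (Fin 3 → Fin 3 → ℝ))
  exact TopologicalSpace.Subtype.secondCountableTopology _

theorem Continuous.integrable_haar {E : Type*} [NormedAddCommGroup E] {f : SO3 → E}
    (hf : Continuous f) : Integrable f SO3.haar :=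
  hf.integrable_of_hasCompactSupport (HasCompactSupport.of_compactSpace f)

/-! ### Schur orthogonality -/

theorem exists_wignerMatrix_eq_diagonal (a : ℝ) :
    ∃ g : SO3, ∀ ℓ, wignerMatrix ℓ g = Matrix.diagonal fun j : Fin (2 * ℓ + 1) =>
      Complex.exp (-Complex.I * (((j : ℕ) : ℂ) - (ℓ : ℂ)) * (a : ℂ)) :=
  ⟨⟨_, quatRotation_mem _ (normSq_quatZ a)⟩, fun ℓ => by
    rw [wignerMatrix_eq_of_quatRotation ℓ (normSq_quatZ a) rfl, unitarySymPow_quatZ]⟩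

/-- For the rotation by `π/2` about the second axis, the last column comes from a multiple of `(X +
1) ^ (2ℓ)`, whose coefficients are nonzero binomials. The same rotation serves all degrees. -/
theorem exists_wignerD_last_ne_zero :
    ∃ g : SO3, ∀ ℓ (i : Fin (2 * ℓ + 1)), wignerD ℓ i (Fin.last (2 * ℓ)) g ≠ 0 := by
  refine ⟨⟨_, quatRotation_mem _ (normSq_quatY (Real.pi / 2))⟩, fun ℓ i => ?_⟩
  rw [← wignerMatrix_apply, wignerMatrix_eq_of_quatRotation ℓ (normSq_quatY _) rfl,
    unitarySymPow_quatY, Complex.ofReal_ne_zero, wignerSmallD]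
  have h1 : Real.cos (Real.pi / 2 / 2) = Real.sqrt 2 / 2 := by
    rw [show Real.pi / 2 / 2 = Real.pi / 4 by ring, Real.cos_pi_div_four]
  have h2 : Real.sin (Real.pi / 2 / 2) = Real.sqrt 2 / 2 := by
    rw [show Real.pi / 2 / 2 = Real.pi / 4 by ring, Real.sin_pi_div_four]
  have hc : (Nat.choose (2 * ℓ) i : ℝ) ≠ 0 :=
    Nat.cast_ne_zero.2 (Nat.choose_pos (Nat.lt_succ_iff.1 i.2)).ne'
  have h3 : (Polynomial.C (Real.sqrt 2 / 2) * Polynomial.X + Polynomial.C (Real.sqrt 2 / 2)) =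
      Polynomial.C (Real.sqrt 2 / 2) * (Polynomial.X + 1) := by ring
  rw [h1, h2, h3, Fin.val_last, Nat.sub_self, pow_zero, mul_one, mul_pow, ← map_pow,
    Polynomial.coeff_C_mul, Polynomial.coeff_X_add_one_pow]
  refine mul_ne_zero (Real.sqrt_pos.2 (by positivity)).ne' (mul_ne_zero (by positivity) hc)

/-- Intertwiners preserve weights: when the weights `i - ℓ` and `j - m` differ by `n ≠ 0`, the
rotation by `π / n` about the third axis gives them opposite phases, so `T i j = -T i j`. -/
theorem intertwiner_apply_eq_zero {ℓ m : ℕ} {T : Matrix (Fin (2 * ℓ + 1)) (Fin (2 * m + 1)) ℂ}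
    (hT : ∀ g, wignerMatrix ℓ g * T = T * wignerMatrix m g) {i : Fin (2 * ℓ + 1)}
    {j : Fin (2 * m + 1)} (hij : (i : ℕ) + m ≠ j + ℓ) : T i j = 0 := by
  set n : ℝ := (i : ℕ) + m - ((j : ℕ) + ℓ) with hn
  have hn0 : n ≠ 0 := by
    rw [hn, sub_ne_zero]
    exact_mod_cast hij
  obtain ⟨g, hg⟩ := exists_wignerMatrix_eq_diagonal (Real.pi / n)
  have h := congrFun (congrFun (hT g) i) j
  rw [hg, hg, Matrix.diagonal_mul, Matrix.mul_diagonal] at h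
  have hn0' : (n : ℂ) ≠ 0 := Complex.ofReal_ne_zero.2 hn0
  have hexp : Complex.exp (-Complex.I * (((j : ℕ) : ℂ) - (m : ℂ)) * ((Real.pi / n : ℝ) : ℂ)) =
      -Complex.exp (-Complex.I * (((i : ℕ) : ℂ) - (ℓ : ℂ)) * ((Real.pi / n : ℝ) : ℂ)) := by
    rw [show -Complex.I * (((j : ℕ) : ℂ) - (m : ℂ)) * ((Real.pi / n : ℝ) : ℂ) =
      -Complex.I * (((i : ℕ) : ℂ) - (ℓ : ℂ)) * ((Real.pi / n : ℝ) : ℂ) + Real.pi * Complex.I by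
        have : (((i : ℕ) : ℂ) + m - ((j : ℕ) + ℓ)) = n := by rw [hn]; push_cast; ring
        push_cast
        field_simp
        linear_combination this,
      Complex.exp_add, Complex.exp_pi_mul_I]
    ring
  rw [hexp] at h
  have h2 : 2 * Complex.exp (-Complex.I * (((i : ℕ) : ℂ) - (ℓ : ℂ)) * ((Real.pi / n : ℝ) : ℂ)) *
      T i j = 0 := by linear_combination h
  exact (mul_eq_zero.1 h2).resolve_left (mul_ne_zero two_ne_zero (Complex.exp_ne_zero _))

/-- The highest weight `m` does not occur in degree `ℓ < m`, so the last column of `T` is zero. In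
the last column of the intertwining relation what remains is `T i j * D^m_{j,last}(g) = 0`, with a
nonzero second factor. -/
theorem intertwiner_eq_zero {ℓ m : ℕ} (hlm : ℓ < m)
    {T : Matrix (Fin (2 * ℓ + 1)) (Fin (2 * m + 1)) ℂ}
    (hT : ∀ g, wignerMatrix ℓ g * T = T * wignerMatrix m g) : T = 0 := by
  ext i j
  by_cases hij : (i : ℕ) + m = j + ℓ
  · obtain ⟨g, hg⟩ := exists_wignerD_last_ne_zero
    have h := congrFun (congrFun (hT g) i) (Fin.last (2 * m))
    rw [Matrix.mul_apply, Matrix.mul_apply, Finset.sum_eq_zero, Finset.sum_eq_single j] at h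
    · exact (mul_eq_zero.1 h.symm).resolve_right (hg m j)
    · intro k _ hk
      rw [intertwiner_apply_eq_zero hT (fun h => hk (Fin.ext (by omega))), zero_mul]
    · simp
    · intro k _
      rw [intertwiner_apply_eq_zero hT (by rw [Fin.val_last]; omega), mul_zero]
  · exact intertwiner_apply_eq_zero hT hij

/-- Distinct indices have distinct weights, so `T` is diagonal. The last column of the relation at a
`g` with no zero there makes all the diagonal entries equal. -/
theorem intertwiner_eq_smul_one {ℓ : ℕ} {T : Matrix (Fin (2 * ℓ + 1)) (Fin (2 * ℓ + 1)) ℂ}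
    (hT : ∀ g, wignerMatrix ℓ g * T = T * wignerMatrix ℓ g) :
    T = (T.trace / (2 * ℓ + 1)) • (1 : Matrix (Fin (2 * ℓ + 1)) (Fin (2 * ℓ + 1)) ℂ) := by
  have hoff {i j : Fin (2 * ℓ + 1)} (hij : i ≠ j) : T i j = 0 :=
    intertwiner_apply_eq_zero hT (fun h => hij (Fin.ext (by omega)))
  have hdiag (i : Fin (2 * ℓ + 1)) : T i i = T (Fin.last _) (Fin.last _) := by
    obtain ⟨g, hg⟩ := exists_wignerD_last_ne_zero
    have h := congrFun (congrFun (hT g) i) (Fin.last (2 * ℓ))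
    rw [Matrix.mul_apply, Matrix.mul_apply, Finset.sum_eq_single (Fin.last _),
      Finset.sum_eq_single i, mul_comm] at h
    · exact (mul_right_cancel₀ (hg ℓ i) h).symm
    · intro k _ hk
      rw [hoff hk.symm, zero_mul]
    · simp
    · intro k _ hk
      rw [hoff hk, mul_zero]
    · simp
  have htr : T.trace = (2 * ℓ + 1) * T (Fin.last _) (Fin.last _) := by
    simp only [Matrix.trace, Matrix.diag_apply, hdiag]
    simp
  have h0 : (2 * ℓ + 1 : ℂ) ≠ 0 := by exact_mod_cast Nat.succ_ne_zero (2 * ℓ)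
  ext i j
  rw [htr, mul_div_cancel_left₀ _ h0, Matrix.smul_apply, smul_eq_mul]
  rcases eq_or_ne i j with rfl | hij
  · rw [Matrix.one_apply_eq, mul_one, hdiag]
  · rw [Matrix.one_apply_ne hij, mul_zero, hoff hij]

theorem continuous_wignerD_mul_conj {ℓ m : ℕ} (i k : Fin (2 * ℓ + 1)) (j l : Fin (2 * m + 1)) :
    Continuous fun x => wignerD ℓ i k x * starRingEnd ℂ (wignerD m j l x) :=
  (continuous_wignerD ℓ i k).mul (Complex.continuous_conj.comp (continuous_wignerD m j l))

/-- Replacing `x` by `g * x` does not change the Haar integral; one factor absorbs `D(g)` on the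
left and, by unitarity, the other releases it on the right. -/
theorem integral_wignerD_intertwines (ℓ m : ℕ) (k : Fin (2 * ℓ + 1)) (l : Fin (2 * m + 1))
    (g : SO3) :
    wignerMatrix ℓ g * (Matrix.of fun i j =>
        ∫ x, wignerD ℓ i k x * starRingEnd ℂ (wignerD m j l x) ∂SO3.haar) =
      (Matrix.of fun i j => ∫ x, wignerD ℓ i k x * starRingEnd ℂ (wignerD m j l x) ∂SO3.haar) *
        wignerMatrix m g := by
  ext i j
  simp only [Matrix.mul_apply, Matrix.of_apply, wignerMatrix_apply, ← integral_const_mul,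
    ← integral_mul_const]
  rw [← integral_finsetSum _ fun p _ =>
      (continuous_wignerD_mul_conj p k j l).integrable_haar.const_mul _,
    ← integral_finsetSum _ fun p _ =>
      (continuous_wignerD_mul_conj i k p l).integrable_haar.mul_const _,
    ← integral_mul_left_eq_self (fun x =>
      ∑ p, wignerD ℓ i k x * starRingEnd ℂ (wignerD m p l x) * wignerD m p j g) g]
  congr 1
  funext x
  have h1 : ∑ p, wignerD ℓ i p g * wignerD ℓ p k x = wignerD ℓ i k (g * x) := by
    rw [← wignerMatrix_apply, wignerMatrix_mul, Matrix.mul_apply]; rfl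
  have h2 : ∑ p, starRingEnd ℂ (wignerD m p l (g * x)) * wignerD m p j g =
      starRingEnd ℂ (wignerD m j l x) := by
    have h := congrFun (congrFun (wignerMatrix_mul m g⁻¹ (g * x)) j) l
    rw [inv_mul_cancel_left, wignerMatrix_inv, Matrix.mul_apply, wignerMatrix_apply] at h
    rw [h, map_sum]
    refine Finset.sum_congr rfl fun p _ => ?_
    rw [map_mul, Matrix.conjTranspose_apply, ← starRingEnd_apply, Complex.conj_conj, mul_comm]
    rfl
  simp only [← mul_assoc]
  rw [← Finset.sum_mul, h1, ← h2, Finset.mul_sum]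
  exact Finset.sum_congr rfl fun p _ => by ring

theorem integral_wignerD_mul_conj_of_lt {ℓ m : ℕ} (h : ℓ < m) (i k : Fin (2 * ℓ + 1))
    (j l : Fin (2 * m + 1)) :
    ∫ x, wignerD ℓ i k x * starRingEnd ℂ (wignerD m j l x) ∂SO3.haar = 0 :=
  congrFun (congrFun (intertwiner_eq_zero h (integral_wignerD_intertwines ℓ m k l)) i) j

theorem integral_wignerD_mul_conj_of_ne {ℓ m : ℕ} (h : ℓ ≠ m) (i k : Fin (2 * ℓ + 1))
    (j l : Fin (2 * m + 1)) :
    ∫ x, wignerD ℓ i k x * starRingEnd ℂ (wignerD m j l x) ∂SO3.haar = 0 := by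
  rcases h.lt_or_gt with h | h
  · exact integral_wignerD_mul_conj_of_lt h i k j l
  · have h1 := integral_wignerD_mul_conj_of_lt h j l i k
    have h2 := congrArg (starRingEnd ℂ) h1
    rw [← integral_conj, map_zero] at h2
    rw [← h2]
    congr 1
    funext x
    rw [map_mul, Complex.conj_conj, mul_comm]

/-- The averaged matrix is scalar, and its trace is the integral of an entry of `D(x)ᴴ D(x) = 1`. -/
theorem integral_wignerD_mul_conj (ℓ : ℕ) (i k j l : Fin (2 * ℓ + 1)) :
    ∫ x, wignerD ℓ i k x * starRingEnd ℂ (wignerD ℓ j l x) ∂SO3.haar =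
      if i = j ∧ k = l then (2 * ℓ + 1 : ℂ)⁻¹ else 0 := by
  have h := intertwiner_eq_smul_one (integral_wignerD_intertwines ℓ ℓ k l)
  have htr : (Matrix.of fun i j => ∫ x, wignerD ℓ i k x * starRingEnd ℂ (wignerD ℓ j l x)
      ∂SO3.haar).trace = if k = l then 1 else 0 := by
    simp only [Matrix.trace, Matrix.diag_apply, Matrix.of_apply]
    rw [← integral_finsetSum _ fun p _ => (continuous_wignerD_mul_conj p k p l).integrable_haar]
    have (x : SO3) : ∑ p, wignerD ℓ p k x * starRingEnd ℂ (wignerD ℓ p l x) =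
        if k = l then 1 else 0 := by
      have hu : (wignerMatrix ℓ x).conjTranspose * wignerMatrix ℓ x = 1 :=
        mul_eq_one_comm.1 (wignerMatrix_mul_conjTranspose ℓ x)
      have h := congrFun (congrFun hu l) k
      rw [Matrix.mul_apply, Matrix.one_apply] at h
      simp only [eq_comm (a := k)]
      rw [← h]
      exact Finset.sum_congr rfl fun p _ => mul_comm _ _
    simp only [this, integral_const]
    simp
  have h2 := congrFun (congrFun h i) j
  rw [htr, Matrix.of_apply, Matrix.smul_apply, Matrix.one_apply] at h2
  rw [h2]
  by_cases hij : i = j <;> by_cases hkl : k = l <;> simp [hij, hkl]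

end

noncomputable section

/-! ### Completeness of the Wigner functions -/

/-- This is `4u²U_n = U_{n+2} + 2U_n + U_{n-2}` at `n = 0`. It is separate from the successor case
because `U_{-2} = -U_0` is not a character of this family. -/
theorem cos_sq_mul_charSO3_zero (x : SO3) :
    (1 + x.1.trace) / 4 * charSO3 0 x = 1 / 4 * charSO3 1 x + 1 / 4 * charSO3 0 x := by
  rw [← quatLift_re_sq, charSO3_eq_eval_quatLift, charSO3_eq_eval_quatLift]
  simp [Polynomial.Chebyshev.U_two]
  ring

theorem cos_sq_mul_charSO3_succ (ℓ : ℕ) (x : SO3) :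
    (1 + x.1.trace) / 4 * charSO3 (ℓ + 1) x =
      1 / 4 * charSO3 (ℓ + 2) x + 1 / 2 * charSO3 (ℓ + 1) x + 1 / 4 * charSO3 ℓ x := by
  rw [← quatLift_re_sq, charSO3_eq_eval_quatLift, charSO3_eq_eval_quatLift,
    charSO3_eq_eval_quatLift]
  have e4 := Polynomial.Chebyshev.U_add_two ℝ (2 * (ℓ : ℤ) + 2)
  have e3 := Polynomial.Chebyshev.U_add_two ℝ (2 * (ℓ : ℤ) + 1)
  have e2 := Polynomial.Chebyshev.U_add_two ℝ (2 * (ℓ : ℤ))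
  rw [show 2 * (ℓ : ℤ) + 2 + 2 = 2 * ((ℓ + 2 : ℕ) : ℤ) by push_cast; ring,
    show 2 * (ℓ : ℤ) + 2 + 1 = 2 * (ℓ : ℤ) + 3 by ring] at e4
  rw [show 2 * (ℓ : ℤ) + 1 + 2 = 2 * (ℓ : ℤ) + 3 by ring,
    show 2 * (ℓ : ℤ) + 1 + 1 = 2 * (ℓ : ℤ) + 2 by ring] at e3
  rw [show 2 * ((ℓ + 1 : ℕ) : ℤ) = 2 * (ℓ : ℤ) + 2 by push_cast; ring, e4, e3, e2]
  simp only [Polynomial.eval_sub, Polynomial.eval_mul, Polynomial.eval_X, Polynomial.eval_ofNat]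
  ring

/-- The span of the characters contains `1` and is stable under multiplication by `cos²(ω/2) = (1 +
tr)/4`. -/
theorem cos_sq_pow_mem_span (N : ℕ) :
    (fun x : SO3 => ((1 + x.1.trace) / 4) ^ N) ∈ Submodule.span ℝ (Set.range charSO3) := by
  induction N with
  | zero =>
    refine Submodule.subset_span ⟨0, ?_⟩
    funext x
    simp [charSO3_zero]
  | succ N ih =>
    have key : ∀ p ∈ Submodule.span ℝ (Set.range charSO3),
        (fun x : SO3 => (1 + x.1.trace) / 4 * p x) ∈ Submodule.span ℝ (Set.range charSO3) := by
      have hm (ℓ : ℕ) (a : ℝ) : a • charSO3 ℓ ∈ Submodule.span ℝ (Set.range charSO3) :=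
        Submodule.smul_mem _ _ (Submodule.subset_span ⟨ℓ, rfl⟩)
      intro p hp
      induction hp using Submodule.span_induction with
      | mem p hp =>
        obtain ⟨ℓ, rfl⟩ := hp
        cases ℓ with
        | zero =>
          rw [funext cos_sq_mul_charSO3_zero]
          exact add_mem (hm 1 _) (hm 0 _)
        | succ ℓ =>
          rw [funext (cos_sq_mul_charSO3_succ ℓ)]
          exact add_mem (add_mem (hm _ _) (hm _ _)) (hm _ _)
      | zero =>
        simp only [Pi.zero_apply, mul_zero]
        exact Submodule.zero_mem _
      | add p q _ _ hp hq =>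
        simp only [Pi.add_apply, mul_add]
        exact add_mem hp hq
      | smul a p _ hp =>
        simp only [Pi.smul_apply, smul_eq_mul, mul_left_comm _ a]
        exact Submodule.smul_mem _ a hp
    simpa only [pow_succ'] using key _ ih

theorem continuous_trace_SO3 : Continuous fun x : SO3 => (1 + x.1.trace) / 4 := by
  have : Continuous fun x : SO3 => x.1.trace := continuous_subtype_val.matrix_trace
  fun_prop

theorem trace_SO3_nonneg (x : SO3) : 0 ≤ (1 + x.1.trace) / 4 := by
  rw [← quatLift_re_sq]; positivity

theorem trace_SO3_le_one (x : SO3) : (1 + x.1.trace) / 4 ≤ 1 := by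
  rw [← quatLift_re_sq]; exact quatLift_re_sq_le_one x

theorem trace_SO3_one : (1 + (1 : SO3).1.trace) / 4 = 1 := by
  have : (1 : SO3).1.trace = 3 := by
    change (1 : Matrix (Fin 3) (Fin 3) ℝ).trace = 3
    simp
  rw [this]; norm_num

/-- Equality forces the imaginary part of the quaternion to vanish. The strict maximum at the
identity makes the powers of this function a peak kernel. -/
theorem trace_SO3_lt_one {x : SO3} (hx : x ≠ 1) : (1 + x.1.trace) / 4 < 1 := by
  refine (trace_SO3_le_one x).lt_of_ne fun h => hx (Subtype.ext ?_)
  rw [← quatLift_re_sq] at h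
  have hn := normSq_quatLift x
  rw [Quaternion.normSq_def'] at hn
  have h1 : (quatLift x).imI = 0 := by
    nlinarith [sq_nonneg (quatLift x).imI, sq_nonneg (quatLift x).imJ, sq_nonneg (quatLift x).imK]
  have h2 : (quatLift x).imJ = 0 := by
    nlinarith [sq_nonneg (quatLift x).imI, sq_nonneg (quatLift x).imJ, sq_nonneg (quatLift x).imK]
  have h3 : (quatLift x).imK = 0 := by
    nlinarith [sq_nonneg (quatLift x).imI, sq_nonneg (quatLift x).imJ, sq_nonneg (quatLift x).imK]
  rw [← quatRotation_quatLift x]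
  change _ = (1 : Matrix (Fin 3) (Fin 3) ℝ)
  ext i j
  fin_cases i <;> fin_cases j <;> simp [quatRotation, h, h1, h2, h3]

/-- The condition that all Fourier coefficients of `h` vanish. -/
def FourierVanishes (h : SO3 → ℂ) : Prop :=
  ∀ ℓ (i j : Fin (2 * ℓ + 1)), ∫ x, h x * starRingEnd ℂ (wignerD ℓ i j x) ∂SO3.haar = 0

theorem integrable_mul_continuous {h g : SO3 → ℂ} (hh : Integrable h SO3.haar)
    (hg : Continuous g) : Integrable (fun x => h x * g x) SO3.haar := by
  obtain ⟨C, hC⟩ := isCompact_univ.exists_bound_of_continuousOn hg.continuousOn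
  exact hh.mul_bdd hg.aestronglyMeasurable (ae_of_all _ fun x => hC x trivial)

theorem integral_mul_charSO3_inv_mul {h : SO3 → ℂ} (hh : Integrable h SO3.haar) (ℓ : ℕ)
    (x : SO3) :
    ∫ y, h y * (charSO3 ℓ (y⁻¹ * x) : ℂ) ∂SO3.haar =
      ∑ i, ∑ j, (∫ y, h y * starRingEnd ℂ (wignerD ℓ i j y) ∂SO3.haar) * wignerD ℓ i j x := by
  have hi (i j : Fin (2 * ℓ + 1)) : Integrable
      (fun y => h y * starRingEnd ℂ (wignerD ℓ i j y) * wignerD ℓ i j x) SO3.haar :=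
    (integrable_mul_continuous hh
      (Complex.continuous_conj.comp (continuous_wignerD ℓ i j))).mul_const _
  simp only [charSO3_inv_mul, Finset.mul_sum, ← mul_assoc]
  rw [integral_finsetSum _ fun i _ => integrable_finsetSum _ fun j _ => hi i j]
  refine Finset.sum_congr rfl fun i _ => ?_
  rw [integral_finsetSum _ fun j _ => hi i j]
  exact Finset.sum_congr rfl fun j _ => integral_mul_const _ _

theorem FourierVanishes.integral_mul_pow {h : SO3 → ℂ} (hv : FourierVanishes h)
    (hh : Integrable h SO3.haar) (N : ℕ) (x : SO3) :
    ∫ y, h y * ((((1 + (y⁻¹ * x).1.trace) / 4) ^ N : ℝ) : ℂ) ∂SO3.haar = 0 := by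
  have key : ∀ p ∈ Submodule.span ℝ (Set.range charSO3), Continuous p ∧
      ∫ y, h y * (p (y⁻¹ * x) : ℂ) ∂SO3.haar = 0 := by
    intro p hp
    have hint {p : SO3 → ℝ} (hp : Continuous p) :
        Integrable (fun y => h y * (p (y⁻¹ * x) : ℂ)) SO3.haar :=
      integrable_mul_continuous hh (by fun_prop)
    induction hp using Submodule.span_induction with
    | mem p hp =>
      obtain ⟨ℓ, rfl⟩ := hp
      refine ⟨continuous_charSO3 ℓ, ?_⟩
      rw [integral_mul_charSO3_inv_mul hh]
      exact Finset.sum_eq_zero fun i _ => Finset.sum_eq_zero fun j _ => by rw [hv, zero_mul]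
    | zero => exact ⟨continuous_const, by simp⟩
    | add p q _ _ hp hq =>
      refine ⟨hp.1.add hq.1, ?_⟩
      simp only [Pi.add_apply, Complex.ofReal_add, mul_add]
      rw [integral_add (hint hp.1) (hint hq.1), hp.2, hq.2, add_zero]
    | smul a p _ hp =>
      refine ⟨hp.1.const_smul a, ?_⟩
      simp only [Pi.smul_apply, smul_eq_mul, Complex.ofReal_mul, mul_left_comm _ (a : ℂ)]
      rw [integral_const_mul, hp.2, mul_zero]
  exact (key _ (cos_sq_pow_mem_span N)).2

/-- Let `G N` be the average of `g` against the normalized `N`-th power of `(1 + tr)/4`, centred at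
`y`. By Fubini `h` integrates to zero against each `G N`. Since `G N` tends to `g` pointwise and is
bounded by the bound `C` for `g`, dominated convergence concludes. -/
theorem FourierVanishes.integral_mul_continuous {h : SO3 → ℂ} (hv : FourierVanishes h)
    (hh : Integrable h SO3.haar) {g : SO3 → ℂ} (hg : Continuous g) :
    ∫ y, h y * g y ∂SO3.haar = 0 := by
  set c : SO3 → ℝ := fun x => (1 + x.1.trace) / 4 with hc
  have hcc : Continuous c := continuous_trace_SO3
  set G : ℕ → SO3 → ℂ := fun N y =>
    (∫ x, c (y⁻¹ * x) ^ N ∂SO3.haar)⁻¹ • ∫ x, c (y⁻¹ * x) ^ N • g x ∂SO3.haar with hG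
  obtain ⟨C, hC⟩ := isCompact_univ.exists_bound_of_continuousOn hg.continuousOn
  have hswap (N : ℕ) : ∫ y, h y * ∫ x, c (y⁻¹ * x) ^ N • g x ∂SO3.haar ∂SO3.haar = 0 := by
    have hcont : Continuous fun z : SO3 × SO3 => ((c (z.1⁻¹ * z.2) ^ N : ℝ) : ℂ) := by fun_prop
    have hi : Integrable (Function.uncurry fun y x => h y * g x * ((c (y⁻¹ * x) ^ N : ℝ) : ℂ))
        (SO3.haar.prod SO3.haar) := by
      refine (hh.mul_prod hg.integrable_haar).mul_bdd (c := 1) hcont.aestronglyMeasurable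
        (ae_of_all _ fun z => ?_)
      rw [Complex.norm_real, norm_pow, Real.norm_of_nonneg (trace_SO3_nonneg _)]
      exact pow_le_one₀ (trace_SO3_nonneg _) (trace_SO3_le_one _)
    have h1 := integral_integral_swap hi
    have h2 : ∀ x, ∫ y, h y * g x * ((c (y⁻¹ * x) ^ N : ℝ) : ℂ) ∂SO3.haar = 0 := fun x => by
      simp only [mul_right_comm _ (g x)]
      rw [integral_mul_const, hv.integral_mul_pow hh, zero_mul]
    simp only [h2, integral_zero] at h1
    rw [← h1]
    congr 1
    funext y
    rw [← integral_const_mul]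
    congr 1
    funext x
    rw [Complex.real_smul]
    ring
  have hzero (N : ℕ) : ∫ y, h y * G N y ∂SO3.haar = 0 := by
    -- By left invariance the normalizing integral does not depend on `y`, so it leaves the outer
    -- integral.
    have hconst (y : SO3) : ∫ x, c (y⁻¹ * x) ^ N ∂SO3.haar = ∫ x, c x ^ N ∂SO3.haar :=
      integral_mul_left_eq_self (fun x => c x ^ N) y⁻¹
    simp only [hG, hconst, mul_smul_comm]
    rw [integral_smul, hswap, smul_zero]
  have hlim (y : SO3) : Tendsto (fun N => G N y) atTop (𝓝 (g y)) := by
    have : TopologicalSpace.MetrizableSpace SO3 :=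
      TopologicalSpace.metrizableSpace_of_t3_secondCountable _
    have h1 : c (y⁻¹ * y) = 1 := by rw [inv_mul_cancel]; exact trace_SO3_one
    have := tendsto_setIntegral_pow_smul_of_unique_maximum_of_isCompact_of_continuousOn
      (μ := SO3.haar) (s := Set.univ) (x₀ := y) (g := g) (c := fun x => c (y⁻¹ * x))
      isCompact_univ (by fun_prop)
      (fun x _ hx => by
        rw [h1]
        exact trace_SO3_lt_one fun h => hx (inv_mul_eq_one.1 h).symm)
      (fun x _ => trace_SO3_nonneg _) (by rw [h1]; exact one_pos) (by simp) hg.continuousOn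
    simpa only [Measure.restrict_univ] using this
  have hbound (N : ℕ) (y : SO3) : ‖G N y‖ ≤ C := by
    have hC0 : 0 ≤ C := (norm_nonneg _).trans (hC 1 trivial)
    have hcN : Integrable (fun x => c (y⁻¹ * x) ^ N) SO3.haar :=
      Continuous.integrable_haar (by fun_prop)
    have hnn : 0 ≤ ∫ x, c (y⁻¹ * x) ^ N ∂SO3.haar :=
      integral_nonneg fun x => pow_nonneg (trace_SO3_nonneg _) _
    have h1 : ‖∫ x, c (y⁻¹ * x) ^ N • g x ∂SO3.haar‖ ≤
        (∫ x, c (y⁻¹ * x) ^ N ∂SO3.haar) * C := by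
      rw [← integral_mul_const]
      refine norm_integral_le_of_norm_le (hcN.mul_const C) (ae_of_all _ fun x => ?_)
      rw [norm_smul, Real.norm_of_nonneg (pow_nonneg (trace_SO3_nonneg _) _)]
      exact mul_le_mul_of_nonneg_left (hC x trivial) (pow_nonneg (trace_SO3_nonneg _) _)
    rw [hG, norm_smul, Real.norm_of_nonneg (inv_nonneg.2 hnn)]
    refine (mul_le_mul_of_nonneg_left h1 (inv_nonneg.2 hnn)).trans ?_
    rw [← mul_assoc]
    -- `inv_mul_le_one` also holds at zero, so the normalizing integral need not be shown positive.
    exact mul_le_of_le_one_left hC0 (inv_mul_le_one)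
  have hmeas (N : ℕ) : Continuous (G N) := by
    have hconst (y : SO3) : ∫ x, c (y⁻¹ * x) ^ N ∂SO3.haar = ∫ x, c x ^ N ∂SO3.haar :=
      integral_mul_left_eq_self (fun x => c x ^ N) y⁻¹
    have hy (y : SO3) : Continuous fun x => c (y⁻¹ * x) ^ N • g x := by fun_prop
    have hx (x : SO3) : Continuous fun y => c (y⁻¹ * x) ^ N • g x := by fun_prop
    have hI : Continuous fun y => ∫ x, c (y⁻¹ * x) ^ N • g x ∂SO3.haar := by
      refine continuous_of_dominated (bound := fun _ => C)
        (fun y => (hy y).aestronglyMeasurable)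
        (fun y => ae_of_all _ fun x => ?_) (integrable_const C) (ae_of_all _ hx)
      rw [norm_smul, norm_pow, Real.norm_of_nonneg (trace_SO3_nonneg _)]
      exact (mul_le_of_le_one_left (norm_nonneg _)
        (pow_le_one₀ (trace_SO3_nonneg _) (trace_SO3_le_one _))).trans (hC x trivial)
    have h2 : G N = fun y => (∫ x, c x ^ N ∂SO3.haar)⁻¹ • ∫ x, c (y⁻¹ * x) ^ N • g x ∂SO3.haar := by
      funext y
      rw [← hconst y]
    rw [h2]
    exact hI.const_smul (∫ x, c x ^ N ∂SO3.haar)⁻¹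
  have hT := tendsto_integral_of_dominated_convergence (μ := SO3.haar)
    (F := fun N y => h y * G N y) (f := fun y => h y * g y) (fun y => ‖h y‖ * C)
    (fun N => hh.aestronglyMeasurable.mul (hmeas N).aestronglyMeasurable)
    (hh.norm.mul_const C)
    (fun N => ae_of_all _ fun y => by
      rw [norm_mul]
      exact mul_le_mul_of_nonneg_left (hbound N y) (norm_nonneg _))
    (ae_of_all _ fun y => (hlim y).const_mul _)
  simp only [hzero] at hT
  exact (tendsto_const_nhds_iff.1 hT).symm

/-! ### The Hilbert basis of Wigner functions and Parseval's identity -/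

/-- The Wigner function as an element of `L²`, of norm one after rescaling. -/
def wignerLp (p : Σ ℓ : ℕ, Fin (2 * ℓ + 1) × Fin (2 * ℓ + 1)) : Lp ℂ 2 SO3.haar :=
  (Real.sqrt (2 * p.1 + 1) : ℂ) •
    ContinuousMap.toLp 2 SO3.haar ℂ ⟨wignerD p.1 p.2.1 p.2.2, continuous_wignerD _ _ _⟩

theorem inner_wignerLp (p : Σ ℓ : ℕ, Fin (2 * ℓ + 1) × Fin (2 * ℓ + 1)) (h : Lp ℂ 2 SO3.haar) :
    inner ℂ (wignerLp p) h = Real.sqrt (2 * p.1 + 1) *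
      ∫ x, h x * starRingEnd ℂ (wignerD p.1 p.2.1 p.2.2 x) ∂SO3.haar := by
  rw [wignerLp, inner_smul_left, Complex.conj_ofReal, L2.inner_def]
  congr 1
  refine integral_congr_ae ?_
  filter_upwards [ContinuousMap.coeFn_toLp (p := 2) SO3.haar (𝕜 := ℂ)
    (⟨wignerD p.1 p.2.1 p.2.2, continuous_wignerD _ _ _⟩ : C(SO3, ℂ))] with x hx
  rw [hx, RCLike.inner_apply]
  rfl

theorem orthonormal_wignerLp : Orthonormal ℂ wignerLp := by
  classical
  rw [orthonormal_iff_ite]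
  rintro ⟨ℓ, i, k⟩ ⟨m, j, l⟩
  rw [wignerLp, wignerLp, inner_smul_left, inner_smul_right, ContinuousMap.inner_toLp,
    Complex.conj_ofReal]
  simp only [ContinuousMap.coe_mk]
  rcases eq_or_ne ℓ m with rfl | hlm
  · rw [integral_wignerD_mul_conj, ← mul_assoc, ← Complex.ofReal_mul,
      Real.mul_self_sqrt (by positivity)]
    have h0 : (2 * ℓ + 1 : ℂ) ≠ 0 := by exact_mod_cast Nat.succ_ne_zero (2 * ℓ)
    by_cases h : j = i ∧ l = k
    · obtain ⟨rfl, rfl⟩ := h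
      simp [h0]
    · rw [if_neg h, mul_zero, if_neg]
      intro h'
      simp only [Sigma.mk.injEq, heq_eq_eq, true_and, Prod.mk.injEq] at h'
      exact h ⟨h'.1.symm, h'.2.symm⟩
  · rw [integral_wignerD_mul_conj_of_ne hlm.symm, if_neg (fun h => hlm (congrArg Sigma.fst h))]
    simp

/-- An element orthogonal to the Wigner functions is orthogonal to every continuous function, and
these are dense in `L²`. -/
theorem orthogonal_span_wignerLp : (Submodule.span ℂ (Set.range wignerLp))ᗮ = ⊥ := by
  rw [Submodule.eq_bot_iff]
  intro h hh
  have hint : Integrable h SO3.haar := (Lp.memLp h).integrable (by norm_num)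
  have hv : FourierVanishes h := fun ℓ i j => by
    have h1 := (Submodule.mem_orthogonal _ _).1 hh _ (Submodule.subset_span ⟨⟨ℓ, i, j⟩, rfl⟩)
    rw [inner_wignerLp] at h1
    refine (mul_eq_zero.1 h1).resolve_left (Complex.ofReal_ne_zero.2 ?_)
    exact (Real.sqrt_pos.2 (by positivity)).ne'
  refine (ContinuousMap.toLp_denseRange ℂ SO3.haar ℂ (p := 2) (by norm_num)).eq_zero_of_inner_left
    (x := h) ℂ fun g => ?_
  have h1 : inner ℂ (ContinuousMap.toLp 2 SO3.haar ℂ g) h = 0 := by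
    rw [L2.inner_def, ← hv.integral_mul_continuous hint (Complex.continuous_conj.comp g.continuous)]
    refine integral_congr_ae ?_
    filter_upwards [ContinuousMap.coeFn_toLp (p := 2) SO3.haar (𝕜 := ℂ) g] with x hx
    rw [hx, RCLike.inner_apply]
    rfl
  rw [← inner_conj_symm, h1, map_zero]

theorem hasSum_fourierCoeff_sq {h : SO3 → ℂ} (hh : MemLp h 2 SO3.haar) :
    HasSum (fun ℓ : ℕ => (2 * (ℓ : ℝ) + 1) * ∑ i, ∑ j,
      ‖∫ x, h x * starRingEnd ℂ (wignerD ℓ i j x) ∂SO3.haar‖ ^ 2)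
      (∫ x, ‖h x‖ ^ 2 ∂SO3.haar) := by
  set b := HilbertBasis.mkOfOrthogonalEqBot orthonormal_wignerLp orthogonal_span_wignerLp
  have h1 := b.hasSum_inner_mul_inner (hh.toLp h) (hh.toLp h)
  simp only [b, HilbertBasis.coe_mkOfOrthogonalEqBot] at h1
  have hc (p) : inner ℂ (wignerLp p) (hh.toLp h) = Real.sqrt (2 * p.1 + 1) *
      ∫ x, h x * starRingEnd ℂ (wignerD p.1 p.2.1 p.2.2 x) ∂SO3.haar := by
    rw [inner_wignerLp]
    congr 1
    refine integral_congr_ae ?_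
    filter_upwards [hh.coeFn_toLp] with x hx
    rw [hx]
  have h2 : inner ℂ (hh.toLp h) (hh.toLp h) = ((∫ x, ‖h x‖ ^ 2 ∂SO3.haar : ℝ) : ℂ) := by
    rw [L2.inner_def]
    refine Eq.trans (integral_congr_ae ?_) (integral_ofReal (𝕜 := ℂ))
    filter_upwards [hh.coeFn_toLp] with x hx
    rw [hx, inner_self_eq_norm_sq_to_K]
    norm_cast
  rw [h2] at h1
  have h3 : HasSum (fun p : Σ ℓ : ℕ, Fin (2 * ℓ + 1) × Fin (2 * ℓ + 1) => (2 * (p.1 : ℝ) + 1) *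
      ‖∫ x, h x * starRingEnd ℂ (wignerD p.1 p.2.1 p.2.2 x) ∂SO3.haar‖ ^ 2)
      (∫ x, ‖h x‖ ^ 2 ∂SO3.haar) := by
    have h4 (p) : inner ℂ (hh.toLp h) (wignerLp p) * inner ℂ (wignerLp p) (hh.toLp h) =
        (((2 * (p.1 : ℝ) + 1) * ‖∫ x, h x * starRingEnd ℂ (wignerD p.1 p.2.1 p.2.2 x)
          ∂SO3.haar‖ ^ 2 : ℝ) : ℂ) := by
      rw [← inner_conj_symm, Complex.conj_mul', hc, norm_mul, Complex.norm_real,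
        Real.norm_of_nonneg (Real.sqrt_nonneg _), ← Complex.ofReal_pow, mul_pow,
        Real.sq_sqrt (by positivity)]
    simp only [h4] at h1
    exact Complex.hasSum_ofReal.1 h1
  -- The sum over all basis elements is grouped by degree.
  refine h3.sigma fun ℓ => ?_
  convert hasSum_fintype _ using 1
  rw [Fintype.sum_prod_type, Finset.mul_sum]
  exact Finset.sum_congr rfl fun i _ => Finset.mul_sum _ _ _

end

noncomputable section

/-! ### Series of characters -/

theorem HasSum.of_eq {ι α : Type*} [AddCommMonoid α] [TopologicalSpace α] {f g : ι → α} {a b : α}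
    (h : HasSum f a) (hfg : ∀ i, g i = f i) (hab : b = a) : HasSum g b := by
  rw [hab, funext hfg]
  exact h

/-- The series of characters with coefficients `a`. -/
def charSeries (a : ℕ → ℝ) (x : SO3) : ℝ := ∑' ℓ : ℕ, a ℓ * charSO3 ℓ x

/-- Absolute summability of a series of characters, uniformly in the argument. -/
def CharSummable (a : ℕ → ℝ) : Prop := Summable fun ℓ : ℕ => |a ℓ| * (2 * (ℓ : ℝ) + 1)

theorem abs_mul_charSO3_le (a : ℕ → ℝ) (ℓ : ℕ) (x : SO3) :
    |a ℓ * charSO3 ℓ x| ≤ |a ℓ| * (2 * (ℓ : ℝ) + 1) := by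
  rw [abs_mul]
  exact mul_le_mul_of_nonneg_left (abs_charSO3_le ℓ x) (abs_nonneg _)

theorem CharSummable.summable {a : ℕ → ℝ} (ha : CharSummable a) (x : SO3) :
    Summable fun ℓ => a ℓ * charSO3 ℓ x :=
  Summable.of_norm_bounded ha fun ℓ => abs_mul_charSO3_le a ℓ x

theorem CharSummable.continuous {a : ℕ → ℝ} (ha : CharSummable a) : Continuous (charSeries a) :=
  continuous_tsum (fun ℓ => (continuous_charSO3 ℓ).const_mul (a ℓ)) ha
    fun ℓ x => abs_mul_charSO3_le a ℓ x

theorem charSeries_inv (a : ℕ → ℝ) (x : SO3) : charSeries a x⁻¹ = charSeries a x := by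
  simp only [charSeries, charSO3_inv]

theorem CharSummable.hasSum_integral {a : ℕ → ℝ} (ha : CharSummable a) {h : SO3 → ℂ}
    (hh : Integrable h SO3.haar) {u : SO3 → SO3} (hu : Continuous u) :
    HasSum (fun ℓ => (a ℓ : ℂ) * ∫ y, h y * (charSO3 ℓ (u y) : ℂ) ∂SO3.haar)
      (∫ y, h y * (charSeries a (u y) : ℂ) ∂SO3.haar) := by
  have hc (ℓ : ℕ) : Continuous fun y => ((a ℓ * charSO3 ℓ (u y) : ℝ) : ℂ) :=
    Complex.continuous_ofReal.comp (continuous_const.mul ((continuous_charSO3 ℓ).comp hu))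
  have key := hasSum_integral_of_summable_integral_norm
    (F := fun ℓ y => h y * ((a ℓ * charSO3 ℓ (u y) : ℝ) : ℂ)) (μ := SO3.haar)
    (fun ℓ => integrable_mul_continuous hh (hc ℓ)) (by
      refine Summable.of_nonneg_of_le (fun ℓ => integral_nonneg fun y => norm_nonneg _)
        (fun ℓ => ?_) (ha.mul_left (∫ y, ‖h y‖ ∂SO3.haar))
      rw [← integral_mul_const]
      refine integral_mono (integrable_mul_continuous hh (hc ℓ)).norm (hh.norm.mul_const _)
        fun y => ?_
      simp only [norm_mul, Complex.norm_real]
      exact mul_le_mul_of_nonneg_left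
        ((norm_mul _ _).symm.le.trans (abs_mul_charSO3_le a ℓ (u y))) (norm_nonneg _))
  refine key.of_eq (fun ℓ => ?_) ?_
  · rw [← integral_const_mul]
    congr 1
    funext y
    push_cast
    ring
  · congr 1
    funext y
    rw [tsum_mul_left, charSeries, Complex.ofReal_tsum]

/-- Convolution with `χ^ℓ` is `1/(2ℓ+1)` times the projection to degree `ℓ`: expand by the addition
formula and use Schur orthogonality. -/
theorem integral_charSO3_mul_conj (ℓ m : ℕ) (s : SO3) (i j : Fin (2 * m + 1)) :
    ∫ y, starRingEnd ℂ (wignerD m i j y) * (charSO3 ℓ (y⁻¹ * s) : ℂ) ∂SO3.haar =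
      if ℓ = m then starRingEnd ℂ (wignerD m i j s) / (2 * m + 1) else 0 := by
  have h (y : SO3) : starRingEnd ℂ (wignerD m i j y) * (charSO3 ℓ (y⁻¹ * s) : ℂ) =
      ∑ p, ∑ q, starRingEnd ℂ (wignerD ℓ p q s) *
        (wignerD ℓ p q y * starRingEnd ℂ (wignerD m i j y)) := by
    rw [← Complex.conj_ofReal, charSO3_inv_mul, map_sum, Finset.mul_sum]
    refine Finset.sum_congr rfl fun p _ => ?_
    rw [map_sum, Finset.mul_sum]
    refine Finset.sum_congr rfl fun q _ => ?_
    rw [map_mul, Complex.conj_conj]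
    ring
  have hi (p q : Fin (2 * ℓ + 1)) : Integrable (fun y => starRingEnd ℂ (wignerD ℓ p q s) *
      (wignerD ℓ p q y * starRingEnd ℂ (wignerD m i j y))) SO3.haar :=
    (continuous_wignerD_mul_conj p q i j).integrable_haar.const_mul _
  simp only [h]
  rw [integral_finsetSum _ fun p _ => integrable_finsetSum _ fun q _ => hi p q]
  simp only [integral_finsetSum _ fun q _ => hi _ q, integral_const_mul]
  split_ifs with hlm
  · subst hlm
    simp only [integral_wignerD_mul_conj, mul_ite, mul_zero, ite_and]
    rw [Finset.sum_eq_single i, Finset.sum_eq_single j]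
    · simp [div_eq_mul_inv]
    · intro q _ hq
      simp [hq]
    · simp
    · intro p _ hp
      simp [hp]
    · simp
  · exact Finset.sum_eq_zero fun p _ => Finset.sum_eq_zero fun q _ => by
      rw [integral_wignerD_mul_conj_of_ne hlm, mul_zero]

theorem CharSummable.integral_mul_conj {a : ℕ → ℝ} (ha : CharSummable a) (m : ℕ) (s : SO3)
    (i j : Fin (2 * m + 1)) :
    ∫ y, (charSeries a (y⁻¹ * s) : ℂ) * starRingEnd ℂ (wignerD m i j y) ∂SO3.haar =
      a m / (2 * m + 1) * starRingEnd ℂ (wignerD m i j s) := by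
  have h := ha.hasSum_integral (h := fun y => starRingEnd ℂ (wignerD m i j y))
    (Complex.continuous_conj.comp (continuous_wignerD m i j)).integrable_haar
    (u := fun y => y⁻¹ * s) (by fun_prop)
  simp only [integral_charSO3_mul_conj] at h
  simp only [mul_comm (charSeries a _ : ℂ)]
  rw [h.unique (hasSum_single m fun ℓ hℓ => by rw [if_neg hℓ, mul_zero]), if_pos rfl]
  ring

theorem CharSummable.fourierCoeffSO3 {a : ℕ → ℝ} (ha : CharSummable a) (m : ℕ)
    (i j : Fin (2 * m + 1)) :
    fourierCoeffSO3 (charSeries a) m i j = if i = j then (a m / (2 * m + 1) : ℂ) else 0 := by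
  have h := ha.integral_mul_conj m 1 i j
  simp only [mul_one, charSeries_inv] at h
  rw [_root_.fourierCoeffSO3, h, ← wignerMatrix_apply, wignerMatrix_one, Matrix.one_apply]
  split_ifs <;> simp

theorem CharSummable.integral_mul_charSeries {a b : ℕ → ℝ} (ha : CharSummable a)
    (hb : CharSummable b) (s x : SO3) :
    HasSum (fun ℓ : ℕ => a ℓ * b ℓ / (2 * ℓ + 1) * charSO3 ℓ (s⁻¹ * x))
      (∫ y, charSeries a (y⁻¹ * s) * charSeries b (y⁻¹ * x) ∂SO3.haar) := by
  have hc : Integrable (fun y => (charSeries a (y⁻¹ * s) : ℂ)) SO3.haar := by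
    have := ha.continuous
    exact Continuous.integrable_haar (by fun_prop)
  have h := hb.hasSum_integral hc (u := fun y => y⁻¹ * x) (by fun_prop)
  rw [← Complex.hasSum_ofReal, ← integral_complex_ofReal]
  refine h.of_eq (fun ℓ => ?_) ?_
  · rw [integral_mul_charSO3_inv_mul hc]
    simp only [ha.integral_mul_conj, mul_assoc, ← Finset.mul_sum]
    push_cast
    rw [charSO3_inv_mul]
    ring
  · simp

/-! ### The heat kernel and the heat wavelets as series of characters -/

/-- One majorant for all the series below; the power four is what `(2ℓ+1)² ℓ(ℓ+1)` in `α` requires.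
-/
theorem summable_pow_four_mul_exp {t : ℝ} (ht : 0 < t) :
    Summable fun ℓ : ℕ => (2 * (ℓ : ℝ) + 1) ^ 4 * Real.exp (-((ℓ : ℝ) * (ℓ + 1) * t)) := by
  have h (k : ℕ) := Real.summable_pow_mul_exp_neg_nat_mul k ht
  have hs : Summable fun ℓ : ℕ => (2 * (ℓ : ℝ) + 1) ^ 4 * Real.exp (-t * ℓ) := by
    refine ((((((h 4).mul_left 16).add ((h 3).mul_left 32)).add ((h 2).mul_left 24)).add
      ((h 1).mul_left 8)).add (h 0)).congr fun ℓ => ?_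
    ring
  refine Summable.of_nonneg_of_le (fun ℓ => by positivity) (fun ℓ => ?_) hs
  refine mul_le_mul_of_nonneg_left (Real.exp_le_exp.2 ?_) (by positivity)
  have : 0 ≤ (ℓ : ℝ) ^ 2 * t := by positivity
  nlinarith

theorem summable_of_le_pow_four_mul_exp {t : ℝ} (ht : 0 < t) {b : ℕ → ℝ}
    (h : ∀ ℓ : ℕ, |b ℓ| ≤ (2 * (ℓ : ℝ) + 1) ^ 4 * Real.exp (-((ℓ : ℝ) * (ℓ + 1) * t))) :
    Summable b :=
  Summable.of_norm_bounded (summable_pow_four_mul_exp ht) h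

theorem one_le_two_mul_add_one (ℓ : ℕ) : (1 : ℝ) ≤ 2 * ℓ + 1 := by
  have : (0 : ℝ) ≤ ℓ := Nat.cast_nonneg ℓ
  linarith

/-- The coefficients of the heat kernel. -/
def heatCoeff (t : ℝ) (ℓ : ℕ) : ℝ := (2 * (ℓ : ℝ) + 1) * Real.exp (-((ℓ : ℝ) * (ℓ + 1) * t))

/-- The coefficients of the heat wavelet, before normalization. -/
def waveletCoeff (ρ : ℝ) (ℓ : ℕ) : ℝ :=
  (2 * (ℓ : ℝ) + 1) * Real.sqrt ((ℓ : ℝ) * (ℓ + 1)) * Real.exp (-((ℓ : ℝ) * (ℓ + 1) / 2 * ρ))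

theorem heatKernelSO3_eq (t : ℝ) : heatKernelSO3 t = charSeries (heatCoeff t) := rfl

theorem heatWavelet_eq (ρ : ℝ) (x : SO3) :
    heatWavelet ρ x = (Real.sqrt (waveletAlpha ρ))⁻¹ * charSeries (waveletCoeff ρ) x := rfl

theorem charSummable_heatCoeff {t : ℝ} (ht : 0 < t) : CharSummable (heatCoeff t) := by
  refine summable_of_le_pow_four_mul_exp ht fun ℓ => ?_
  have h1 := one_le_two_mul_add_one ℓ
  have h0 : (0 : ℝ) ≤ 2 * ℓ + 1 := by positivity
  rw [heatCoeff, abs_of_nonneg (by positivity), abs_of_nonneg (by positivity), mul_right_comm,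
    ← sq]
  exact mul_le_mul_of_nonneg_right (pow_le_pow_right₀ h1 (by norm_num)) (Real.exp_nonneg _)

theorem charSummable_waveletCoeff {ρ : ℝ} (hρ : 0 < ρ) : CharSummable (waveletCoeff ρ) := by
  -- The wavelet decays like `e^{-ℓ(ℓ+1)ρ/2}`, hence the majorant at `ρ / 2`.
  refine summable_of_le_pow_four_mul_exp (half_pos hρ) fun ℓ => ?_
  have h1 := one_le_two_mul_add_one ℓ
  have h0 : (0 : ℝ) ≤ 2 * ℓ + 1 := by positivity
  have h2 : Real.sqrt ((ℓ : ℝ) * (ℓ + 1)) ≤ 2 * ℓ + 1 :=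
    Real.sqrt_le_iff.2 ⟨h0, by nlinarith [(Nat.cast_nonneg ℓ : (0 : ℝ) ≤ ℓ)]⟩
  rw [waveletCoeff, abs_of_nonneg (by positivity), abs_of_nonneg (by positivity), mul_right_comm,
    show (ℓ : ℝ) * (ℓ + 1) / 2 * ρ = ℓ * (ℓ + 1) * (ρ / 2) by ring]
  refine mul_le_mul_of_nonneg_right ?_ (Real.exp_nonneg _)
  calc (2 * (ℓ : ℝ) + 1) * Real.sqrt ((ℓ : ℝ) * (ℓ + 1)) * (2 * ℓ + 1)
      ≤ (2 * (ℓ : ℝ) + 1) * (2 * ℓ + 1) * (2 * ℓ + 1) := by gcongr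
    _ = (2 * (ℓ : ℝ) + 1) ^ 3 := by ring
    _ ≤ _ := pow_le_pow_right₀ h1 (by norm_num)

theorem waveletAlpha_pos {ρ : ℝ} (hρ : 0 < ρ) : 0 < waveletAlpha ρ := by
  have hs : Summable fun ℓ : ℕ => (2 * (ℓ : ℝ) + 1) ^ 2 * ((ℓ : ℝ) * (ℓ + 1)) *
      Real.exp (-((ℓ : ℝ) * (ℓ + 1) * ρ)) := by
    refine summable_of_le_pow_four_mul_exp hρ fun ℓ => ?_
    rw [abs_of_nonneg (by positivity)]
    refine mul_le_mul_of_nonneg_right ?_ (Real.exp_nonneg _)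
    have : (ℓ : ℝ) * (ℓ + 1) ≤ (2 * ℓ + 1) ^ 2 := by
      nlinarith [(Nat.cast_nonneg ℓ : (0 : ℝ) ≤ ℓ)]
    calc _ ≤ (2 * (ℓ : ℝ) + 1) ^ 2 * (2 * ℓ + 1) ^ 2 := by gcongr
      _ = _ := by ring
  exact hs.tsum_pos (fun ℓ => by positivity) 1 (by positivity)

/-- The factor `α(ρ)` cancels the two normalizations, the square roots multiply to `ℓ(ℓ+1)`, and the
half exponents add up. The first argument `y⁻¹ * s` is the inverse of `s⁻¹ * y`, as the reflected
wavelet demands. -/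
theorem hasSum_integral_heatWavelet_mul {ρ : ℝ} (hρ : 0 < ρ) (s x : SO3) :
    HasSum (fun ℓ : ℕ => (2 * (ℓ : ℝ) + 1) * (ℓ * (ℓ + 1)) *
        Real.exp (-((ℓ : ℝ) * (ℓ + 1) * ρ)) * charSO3 ℓ (s⁻¹ * x))
      ((∫ y, heatWavelet ρ (y⁻¹ * s) * heatWavelet ρ (y⁻¹ * x) ∂SO3.haar) * waveletAlpha ρ) := by
  have hα := waveletAlpha_pos hρ
  have h := (charSummable_waveletCoeff hρ).integral_mul_charSeries
    (charSummable_waveletCoeff hρ) s x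
  refine h.of_eq (fun ℓ => ?_) ?_
  · have h0 : (2 * (ℓ : ℝ) + 1) ≠ 0 := by positivity
    have hsq : Real.sqrt ((ℓ : ℝ) * (ℓ + 1)) * Real.sqrt ((ℓ : ℝ) * (ℓ + 1)) = ℓ * (ℓ + 1) :=
      Real.mul_self_sqrt (by positivity)
    have hexp : Real.exp (-((ℓ : ℝ) * (ℓ + 1) / 2 * ρ)) * Real.exp (-((ℓ : ℝ) * (ℓ + 1) / 2 * ρ)) =
        Real.exp (-((ℓ : ℝ) * (ℓ + 1) * ρ)) := by
      rw [← Real.exp_add]; ring_nf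
    rw [waveletCoeff, ← hexp]
    field_simp
    linear_combination (-charSO3 ℓ (s⁻¹ * x)) * hsq
  · have hsq : Real.sqrt (waveletAlpha ρ) * Real.sqrt (waveletAlpha ρ) = waveletAlpha ρ :=
      Real.mul_self_sqrt hα.le
    have hs0 : Real.sqrt (waveletAlpha ρ) ≠ 0 := (Real.sqrt_pos.2 hα).ne'
    rw [← integral_mul_const]
    congr 1
    funext y
    rw [heatWavelet_eq, heatWavelet_eq]
    nth_rw 3 [← hsq]
    field_simp

theorem continuous_heatWavelet {ρ : ℝ} (hρ : 0 < ρ) : Continuous (heatWavelet ρ) :=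
  (charSummable_waveletCoeff hρ).continuous.const_mul _

theorem hasSum_integral_empiricalWT_mul {K : ℕ} (s : Fin K → SO3) {ρ : ℝ} (hρ : 0 < ρ) (x : SO3) :
    HasSum (fun ℓ : ℕ => (2 * (ℓ : ℝ) + 1) * ((K : ℝ)⁻¹ * ∑ k, charSO3 ℓ ((s k)⁻¹ * x)) *
        ((ℓ * (ℓ + 1)) * Real.exp (-((ℓ : ℝ) * (ℓ + 1)) * ρ)))
      ((∫ y, empiricalWT s ρ y * heatWavelet ρ (y⁻¹ * x) ∂SO3.haar) * waveletAlpha ρ) := by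
  have hc := continuous_heatWavelet hρ
  have h := (hasSum_sum (s := Finset.univ) fun k _ =>
    hasSum_integral_heatWavelet_mul hρ (s k) x).mul_left (K : ℝ)⁻¹
  refine h.of_eq (fun ℓ => ?_) ?_
  · rw [Finset.mul_sum, Finset.mul_sum, Finset.mul_sum, Finset.sum_mul]
    refine Finset.sum_congr rfl fun k _ => ?_
    rw [neg_mul]
    ring
  · rw [← Finset.sum_mul,
      ← integral_finsetSum _ fun k _ => Continuous.integrable_haar (by fun_prop),
      ← mul_assoc, ← integral_const_mul]
    congr 2
    funext y
    simp only [empiricalWT, mul_inv_rev, inv_inv, ← Finset.sum_mul, mul_assoc]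

/-- For `ℓ ≥ 1` the integral of `ℓ(ℓ+1) e^{-ℓ(ℓ+1)ρ}` over `ρ > t` is `e^{-ℓ(ℓ+1)t}`. For `ℓ = 0` it
is zero, while the heat kernel average has the term `β 0 = 1`, supplied by the constant of the
estimator. -/
theorem heatWaveletEstimator_eq {K : ℕ} (hK : 1 ≤ K) (s : Fin K → SO3) {t : ℝ} (ht : 0 < t)
    (x : SO3) :
    heatWaveletEstimator s t x = (K : ℝ)⁻¹ * ∑ k, heatKernelSO3 t ((s k)⁻¹ * x) := by
  set β : ℕ → ℝ := fun ℓ => (K : ℝ)⁻¹ * ∑ k, charSO3 ℓ ((s k)⁻¹ * x) with hβ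
  have hK0 : (K : ℝ) ≠ 0 := Nat.cast_ne_zero.2 (by omega)
  have hβ0 : β 0 = 1 := by simp [hβ, charSO3_zero, hK0]
  have hβle (ℓ : ℕ) : |β ℓ| ≤ 2 * ℓ + 1 := by
    rw [hβ, abs_mul, abs_of_nonneg (by positivity), inv_mul_le_iff₀ (by positivity)]
    refine (Finset.abs_sum_le_sum_abs _ _).trans
      ((Finset.sum_le_sum fun k _ => abs_charSO3_le ℓ _).trans ?_)
    rw [Finset.sum_const, Finset.card_univ, Fintype.card_fin, nsmul_eq_mul]
  have hsum : HasSum (fun ℓ => heatCoeff t ℓ * β ℓ)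
      ((K : ℝ)⁻¹ * ∑ k, heatKernelSO3 t ((s k)⁻¹ * x)) := by
    have h := (hasSum_sum (s := Finset.univ) fun k _ =>
      ((charSummable_heatCoeff ht).summable ((s k)⁻¹ * x)).hasSum).mul_left (K : ℝ)⁻¹
    refine h.of_eq (fun ℓ => ?_) rfl
    rw [hβ, ← Finset.mul_sum]
    ring
  set F : ℕ → ℝ → ℝ := fun ℓ ρ => (2 * (ℓ : ℝ) + 1) * β ℓ *
    ((ℓ * (ℓ + 1)) * Real.exp (-((ℓ : ℝ) * (ℓ + 1)) * ρ)) with hF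
  have hexp (ℓ : ℕ) : IntegrableOn
      (fun ρ => (ℓ * (ℓ + 1)) * Real.exp (-((ℓ : ℝ) * (ℓ + 1)) * ρ)) (Set.Ioi t) := by
    -- At `ℓ = 0` the exponential does not decay, but the factor `ℓ(ℓ+1)` vanishes.
    rcases Nat.eq_zero_or_pos ℓ with rfl | hℓ
    · simp
    · exact (integrableOn_exp_mul_Ioi (neg_neg_of_pos (by positivity)) t).const_mul _
  have hint (ℓ : ℕ) : ∫ ρ in Set.Ioi t, (ℓ * (ℓ + 1)) * Real.exp (-((ℓ : ℝ) * (ℓ + 1)) * ρ) =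
      if ℓ = 0 then 0 else Real.exp (-((ℓ : ℝ) * (ℓ + 1) * t)) := by
    split_ifs with hℓ
    · simp [hℓ]
    · have h0 : (0 : ℝ) < ℓ * (ℓ + 1) := by
        have : 0 < ℓ := Nat.pos_of_ne_zero hℓ
        positivity
      rw [integral_const_mul, integral_exp_mul_Ioi (neg_neg_of_pos h0), neg_div_neg_eq,
        mul_div_cancel₀ _ h0.ne', neg_mul]
  have hsw := hasSum_integral_of_summable_integral_norm (F := F) (μ := volume.restrict (Set.Ioi t))
    (fun ℓ => (hexp ℓ).const_mul _) (by
      refine summable_of_le_pow_four_mul_exp ht fun ℓ => ?_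
      have h1 := one_le_two_mul_add_one ℓ
      have hn (ρ : ℝ) : ‖F ℓ ρ‖ = |(2 * (ℓ : ℝ) + 1) * β ℓ| *
          ((ℓ * (ℓ + 1)) * Real.exp (-((ℓ : ℝ) * (ℓ + 1)) * ρ)) := by
        rw [hF, Real.norm_eq_abs, abs_mul, abs_of_nonneg (a := (ℓ * (ℓ + 1) : ℝ) * _)]
        positivity
      simp only [hn]
      rw [integral_const_mul, hint, abs_mul, abs_abs, abs_mul, abs_of_nonneg (a := 2 * (ℓ : ℝ) + 1)
        (by positivity)]
      refine mul_le_mul ?_ ?_ (abs_nonneg _) (by positivity)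
      · calc (2 * (ℓ : ℝ) + 1) * |β ℓ| ≤ (2 * (ℓ : ℝ) + 1) * (2 * ℓ + 1) := by
              gcongr
              exact hβle ℓ
          _ = (2 * (ℓ : ℝ) + 1) ^ 2 := by ring
          _ ≤ _ := pow_le_pow_right₀ h1 (by norm_num)
      · split_ifs
        · simpa using Real.exp_nonneg _
        · rw [abs_of_nonneg (Real.exp_nonneg _)])
  have hest : heatWaveletEstimator s t x = 1 + ∫ ρ in Set.Ioi t, ∑' ℓ, F ℓ ρ := by
    rw [heatWaveletEstimator]
    congr 1
    refine setIntegral_congr_fun measurableSet_Ioi fun ρ hρ => ?_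
    exact (hasSum_integral_empiricalWT_mul s (ht.trans hρ) x).tsum_eq.symm
  -- The constant `1` is written as a series supported at `ℓ = 0`, to be added to the integrated
  -- series.
  have h1 := (hasSum_single (f := fun ℓ : ℕ => if ℓ = 0 then (1 : ℝ) else 0) 0
    (fun ℓ hℓ => if_neg hℓ)).add hsw
  rw [hest]
  refine HasSum.unique (by simpa using h1) ?_
  refine hsum.of_eq (fun ℓ => ?_) rfl
  simp only [hF, integral_const_mul, hint, heatCoeff]
  split_ifs with hℓ
  · subst hℓ
    simp [hβ0]
  · ring

end

noncomputable section

/-! ### Fourier coefficients of real functions -/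

theorem normSqSO3_eq_ofReal {h : SO3 → ℝ} (hh : MemLp h 2 SO3.haar) :
    normSqSO3 h = ENNReal.ofReal (∫ x, h x ^ 2 ∂SO3.haar) :=
  (ofReal_integral_eq_lintegral_ofReal hh.integrable_sq (ae_of_all _ fun _ => sq_nonneg _)).symm

theorem normSqSO3_toReal {h : SO3 → ℝ} (hh : MemLp h 2 SO3.haar) :
    (normSqSO3 h).toReal = ∫ x, h x ^ 2 ∂SO3.haar := by
  rw [normSqSO3_eq_ofReal hh, ENNReal.toReal_ofReal (integral_nonneg fun _ => sq_nonneg _)]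

theorem normSqSO3_ne_top {h : SO3 → ℝ} (hh : MemLp h 2 SO3.haar) : normSqSO3 h ≠ ⊤ := by
  rw [normSqSO3_eq_ofReal hh]; exact ENNReal.ofReal_ne_top

theorem Continuous.memLp_haar {h : SO3 → ℝ} (hh : Continuous h) : MemLp h 2 SO3.haar := by
  obtain ⟨C, hC⟩ := isCompact_univ.exists_bound_of_continuousOn hh.continuousOn
  exact MemLp.of_bound hh.aestronglyMeasurable C (ae_of_all _ fun x => hC x trivial)

theorem fourierSq_nonneg (f : SO3 → ℝ) (ℓ : ℕ) : 0 ≤ fourierSq f ℓ := by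
  unfold fourierSq; positivity

theorem hasSum_fourierSq {h : SO3 → ℝ} (hh : MemLp h 2 SO3.haar) :
    HasSum (fun ℓ : ℕ => (2 * (ℓ : ℝ) + 1) ^ 2 * fourierSq h ℓ) (∫ x, h x ^ 2 ∂SO3.haar) := by
  refine (hasSum_fourierCoeff_sq (hh.ofReal (K := ℂ))).of_eq (fun ℓ => ?_) ?_
  · have h0 : (2 * (ℓ : ℝ) + 1) ≠ 0 := by positivity
    rw [fourierSq, ← mul_assoc]
    congr 1
    field_simp
  · congr 1
    funext x
    simp

theorem fourierSq_eq_mul {f h : SO3 → ℝ} {ℓ : ℕ} (c : ℝ)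
    (hc : ∀ i j, fourierCoeffSO3 h ℓ i j = c * fourierCoeffSO3 f ℓ i j) :
    fourierSq h ℓ = c ^ 2 * fourierSq f ℓ := by
  simp only [fourierSq, hc, norm_mul, Complex.norm_real, mul_pow, Real.norm_eq_abs, sq_abs,
    ← Finset.mul_sum]
  ring

theorem fourierSq_charSeries {a : ℕ → ℝ} (ha : CharSummable a) (ℓ : ℕ) :
    fourierSq (charSeries a) ℓ = (a ℓ / (2 * ℓ + 1)) ^ 2 := by
  have h0 : (2 * (ℓ : ℝ) + 1) ≠ 0 := by positivity
  have h (i : Fin (2 * ℓ + 1)) : ∑ j, ‖fourierCoeffSO3 (charSeries a) ℓ i j‖ ^ 2 =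
      (a ℓ / (2 * ℓ + 1)) ^ 2 := by
    rw [Finset.sum_eq_single i]
    · have : (a ℓ / (2 * ℓ + 1) : ℂ) = ((a ℓ / (2 * ℓ + 1) : ℝ) : ℂ) := by push_cast; rfl
      rw [ha.fourierCoeffSO3, if_pos rfl, this, Complex.norm_real, Real.norm_eq_abs, sq_abs]
    · intro j _ hj
      rw [ha.fourierCoeffSO3, if_neg hj.symm, norm_zero, zero_pow two_ne_zero]
    · simp
  simp only [fourierSq, h]
  rw [Finset.sum_const, Finset.card_univ, Fintype.card_fin, nsmul_eq_mul]
  push_cast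
  field_simp

theorem fourierCoeffSO3_sub {f h : SO3 → ℝ} (hf : Integrable f SO3.haar)
    (hh : Integrable h SO3.haar) (ℓ : ℕ) (i j : Fin (2 * ℓ + 1)) :
    fourierCoeffSO3 (fun x => f x - h x) ℓ i j =
      fourierCoeffSO3 f ℓ i j - fourierCoeffSO3 h ℓ i j := by
  have hc : Continuous fun x => starRingEnd ℂ (wignerD ℓ i j x) :=
    Complex.continuous_conj.comp (continuous_wignerD ℓ i j)
  simp only [fourierCoeffSO3, Complex.ofReal_sub, sub_mul]
  exact integral_sub (integrable_mul_continuous hf.ofReal hc)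
    (integrable_mul_continuous hh.ofReal hc)

theorem continuous_convSO3 {f k : SO3 → ℝ} (hf : Integrable f SO3.haar) (hk : Continuous k) :
    Continuous (convSO3 f k) := by
  obtain ⟨C, hC⟩ := isCompact_univ.exists_bound_of_continuousOn hk.continuousOn
  have hy (x : SO3) : Continuous fun y => k (y⁻¹ * x) := by fun_prop
  have hx (y : SO3) : Continuous fun x => f y * k (y⁻¹ * x) := by fun_prop
  refine continuous_of_dominated (bound := fun y => ‖f y‖ * C)
    (fun x => hf.aestronglyMeasurable.mul (hy x).aestronglyMeasurable)
    (fun x => ae_of_all _ fun y => ?_) (hf.norm.mul_const C) (ae_of_all _ hx)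
  rw [norm_mul]
  exact mul_le_mul_of_nonneg_left (hC _ trivial) (norm_nonneg _)

theorem integrable_conv_kernel {f k : SO3 → ℝ} (hf : Integrable f SO3.haar) (hk : Continuous k) :
    Integrable (fun z : SO3 × SO3 => f z.2 * k (z.2⁻¹ * z.1)) (SO3.haar.prod SO3.haar) := by
  obtain ⟨C, hC⟩ := isCompact_univ.exists_bound_of_continuousOn hk.continuousOn
  have h1 : Continuous fun z : SO3 × SO3 => k (z.2⁻¹ * z.1) := by fun_prop
  exact (hf.comp_snd SO3.haar).mul_bdd h1.aestronglyMeasurable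
    (ae_of_all _ fun z => hC _ trivial)

theorem integral_convSO3 {f k : SO3 → ℝ} (hf : Integrable f SO3.haar) (hk : Continuous k) :
    ∫ x, convSO3 f k x ∂SO3.haar = (∫ x, f x ∂SO3.haar) * ∫ x, k x ∂SO3.haar := by
  simp only [convSO3]
  rw [integral_integral_swap (integrable_conv_kernel hf hk), ← integral_mul_const]
  congr 1
  funext y
  rw [integral_const_mul, integral_mul_left_eq_self]

/-- Character series are invariant under inversion, so the kernel may be read as a function of `x⁻¹
* y`; after Fubini the inner integral is `integral_mul_conj`. -/
theorem fourierCoeffSO3_conv {f : SO3 → ℝ} (hf : Integrable f SO3.haar) {a : ℕ → ℝ}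
    (ha : CharSummable a) (ℓ : ℕ) (i j : Fin (2 * ℓ + 1)) :
    fourierCoeffSO3 (convSO3 f (charSeries a)) ℓ i j =
      ((a ℓ / (2 * ℓ + 1) : ℝ) : ℂ) * fourierCoeffSO3 f ℓ i j := by
  have hc : Continuous fun x => starRingEnd ℂ (wignerD ℓ i j x) :=
    Complex.continuous_conj.comp (continuous_wignerD ℓ i j)
  have hint : Integrable (Function.uncurry fun x y => (f y : ℂ) *
      ((charSeries a (x⁻¹ * y) : ℂ) * starRingEnd ℂ (wignerD ℓ i j x)))
      (SO3.haar.prod SO3.haar) := by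
    have hs := ha.continuous
    have hcont : Continuous fun z : SO3 × SO3 =>
        (charSeries a (z.1⁻¹ * z.2) : ℂ) * starRingEnd ℂ (wignerD ℓ i j z.1) :=
      (Complex.continuous_ofReal.comp (hs.comp (by fun_prop))).mul (hc.comp continuous_fst)
    obtain ⟨C, hC⟩ := isCompact_univ.exists_bound_of_continuousOn hcont.continuousOn
    have hf' : Integrable (fun z : SO3 × SO3 => (f z.2 : ℂ)) (SO3.haar.prod SO3.haar) :=
      Integrable.comp_snd (f := fun y => (f y : ℂ)) hf.ofReal SO3.haar
    exact hf'.mul_bdd hcont.aestronglyMeasurable (ae_of_all _ fun z => hC z trivial)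
  have h1 (x : SO3) : (convSO3 f (charSeries a) x : ℂ) * starRingEnd ℂ (wignerD ℓ i j x) =
      ∫ y, (f y : ℂ) * ((charSeries a (x⁻¹ * y) : ℂ) * starRingEnd ℂ (wignerD ℓ i j x))
        ∂SO3.haar := by
    rw [convSO3, ← integral_complex_ofReal, ← integral_mul_const]
    congr 1
    funext y
    rw [← charSeries_inv a (x⁻¹ * y), mul_inv_rev, inv_inv]
    push_cast
    ring
  simp only [fourierCoeffSO3, h1]
  rw [integral_integral_swap hint]
  simp only [integral_const_mul, ha.integral_mul_conj]
  rw [← integral_const_mul]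
  congr 1
  funext y
  push_cast
  ring

theorem fourierSq_zero_eq_one {f : SO3 → ℝ} (hf : ∫ x, f x ∂SO3.haar = 1) : fourierSq f 0 = 1 := by
  have hD (x : SO3) : wignerD 0 0 0 x = 1 := by
    have h := charSO3_eq_sum 0 x
    rw [charSO3_zero] at h
    simpa using h.symm
  have hc : fourierCoeffSO3 f 0 0 0 = 1 := by
    simp only [fourierCoeffSO3, hD, map_one, mul_one]
    rw [integral_complex_ofReal, hf, Complex.ofReal_one]
  have hs : ∑ i : Fin (2 * 0 + 1), ∑ j : Fin (2 * 0 + 1), ‖fourierCoeffSO3 f 0 i j‖ ^ 2 =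
      ‖fourierCoeffSO3 f 0 0 0‖ ^ 2 := by
    rw [Fin.sum_univ_one, Fin.sum_univ_one]
  rw [fourierSq, hs, hc]
  simp

/-- Jensen's inequality for the probability measure `f dμ`, obtained from the nonnegative variance
of `‖g‖` about its mean `A`. -/
theorem norm_integral_mul_sq_le {f : SO3 → ℝ} (hf : Integrable f SO3.haar)
    (hf0 : 0 ≤ᵐ[SO3.haar] f) (hf1 : ∫ x, f x ∂SO3.haar = 1) {g : SO3 → ℂ} (hg : Continuous g) :
    ‖∫ x, (f x : ℂ) * g x ∂SO3.haar‖ ^ 2 ≤ ∫ x, f x * ‖g x‖ ^ 2 ∂SO3.haar := by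
  have hi {h : SO3 → ℝ} (hh : Continuous h) : Integrable (fun x => f x * h x) SO3.haar := by
    obtain ⟨C, hC⟩ := isCompact_univ.exists_bound_of_continuousOn hh.continuousOn
    exact hf.mul_bdd hh.aestronglyMeasurable (ae_of_all _ fun x => hC x trivial)
  set A := ∫ x, f x * ‖g x‖ ∂SO3.haar with hA
  have h1 : ‖∫ x, (f x : ℂ) * g x ∂SO3.haar‖ ≤ A := by
    refine norm_integral_le_of_norm_le (hi hg.norm) ?_
    filter_upwards [hf0] with x hx
    rw [norm_mul, Complex.norm_real, Real.norm_of_nonneg hx]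
  have h2 : 0 ≤ ∫ x, f x * (‖g x‖ - A) ^ 2 ∂SO3.haar := by
    refine integral_nonneg_of_ae ?_
    filter_upwards [hf0] with x hx
    exact mul_nonneg hx (sq_nonneg _)
  have h3 : ∫ x, f x * (‖g x‖ - A) ^ 2 ∂SO3.haar = (∫ x, f x * ‖g x‖ ^ 2 ∂SO3.haar) - A ^ 2 := by
    have : ∀ x, f x * (‖g x‖ - A) ^ 2 = f x * ‖g x‖ ^ 2 - 2 * A * (f x * ‖g x‖) + A ^ 2 * f x :=
      fun x => by ring
    simp only [this]
    have h4 : Integrable (fun x => f x * ‖g x‖ ^ 2) SO3.haar := hi (hg.norm.pow 2)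
    have h5 : Integrable (fun x => 2 * A * (f x * ‖g x‖)) SO3.haar := (hi hg.norm).const_mul _
    have h6 : Integrable (fun x => f x * ‖g x‖ ^ 2 - 2 * A * (f x * ‖g x‖)) SO3.haar := h4.sub h5
    rw [integral_add h6 (hf.const_mul _),
      integral_sub h4 h5, integral_const_mul,
      integral_const_mul, hf1, ← hA]
    ring
  nlinarith [norm_nonneg (∫ x, (f x : ℂ) * g x ∂SO3.haar)]

/-- Jensen bounds each squared coefficient by the `f`-mean of `|D_{nm}|²`. A row of a unitary matrix
has norm one, so each of the `2ℓ+1` rows contributes at most one. -/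
theorem fourierSq_le_one {f : SO3 → ℝ} (hf : Integrable f SO3.haar)
    (hf0 : 0 ≤ᵐ[SO3.haar] f) (hf1 : ∫ x, f x ∂SO3.haar = 1) (ℓ : ℕ) : fourierSq f ℓ ≤ 1 := by
  have hc (i j : Fin (2 * ℓ + 1)) : Continuous fun x => starRingEnd ℂ (wignerD ℓ i j x) :=
    Complex.continuous_conj.comp (continuous_wignerD ℓ i j)
  have hi (i j : Fin (2 * ℓ + 1)) : Integrable (fun x => f x * ‖wignerD ℓ i j x‖ ^ 2) SO3.haar := by
    refine hf.mul_bdd (c := 1) ((continuous_wignerD ℓ i j).norm.pow 2).aestronglyMeasurable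
      (ae_of_all _ fun x => ?_)
    rw [norm_pow, norm_norm]
    exact pow_le_one₀ (norm_nonneg _) (norm_wignerD_le_one ℓ i j x)
  have hrow (i : Fin (2 * ℓ + 1)) : ∑ j, ‖fourierCoeffSO3 f ℓ i j‖ ^ 2 ≤ 1 := by
    calc ∑ j, ‖fourierCoeffSO3 f ℓ i j‖ ^ 2
        ≤ ∑ j, ∫ x, f x * ‖wignerD ℓ i j x‖ ^ 2 ∂SO3.haar := by
          refine Finset.sum_le_sum fun j _ => ?_
          have := norm_integral_mul_sq_le hf hf0 hf1 (hc i j)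
          simpa only [fourierCoeffSO3, RCLike.norm_conj] using this
      _ = 1 := by
          rw [← integral_finsetSum _ fun j _ => hi i j, ← hf1]
          congr 1
          funext x
          rw [← Finset.mul_sum, sum_norm_sq_wignerD, mul_one]
  rw [fourierSq, inv_mul_le_iff₀ (by positivity), mul_one]
  refine (Finset.sum_le_sum fun i _ => hrow i).trans ?_
  simp

/-! ### Bias and variance of a kernel estimator -/

theorem integral_comp_of_density {Ω : Type*} [MeasurableSpace Ω] {P : Measure Ω} {f : SO3 → ℝ}
    {Y : Ω → SO3} (hf : Integrable f SO3.haar)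
    (hf0 : 0 ≤ᵐ[SO3.haar] f) (hY : Measurable Y)
    (hlaw : P.map Y = SO3.haar.withDensity (fun x => ENNReal.ofReal (f x)))
    {g : SO3 → ℝ} (hg : Continuous g) : ∫ ω, g (Y ω) ∂P = ∫ y, f y * g y ∂SO3.haar := by
  rw [← integral_map hY.aemeasurable hg.aestronglyMeasurable, hlaw,
    integral_withDensity_eq_integral_toReal_smul₀ hf.aemeasurable.ennreal_ofReal
      (ae_of_all _ fun _ => ENNReal.ofReal_lt_top)]
  refine integral_congr_ae ?_
  filter_upwards [hf0] with x hx
  rw [ENNReal.toReal_ofReal hx, smul_eq_mul]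

section Estimator

variable {Ω : Type*} [MeasurableSpace Ω] {P : Measure Ω} [IsProbabilityMeasure P]
  {f : SO3 → ℝ} {K : ℕ} {X : Fin K → Ω → SO3} {k : SO3 → ℝ}

theorem memLp_comp {Y : Ω → SO3} (hY : Measurable Y) {g : SO3 → ℝ} (hg : Continuous g) :
    MemLp (fun ω => g (Y ω)) 2 P := by
  obtain ⟨C, hC⟩ := isCompact_univ.exists_bound_of_continuousOn hg.continuousOn
  exact MemLp.of_bound (hg.measurable.comp hY).aestronglyMeasurable C
    (ae_of_all _ fun ω => hC _ trivial)

/-- The kernel estimator with kernel `k` built from the sample `s`. -/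
def kernelEstimator (k : SO3 → ℝ) (s : Fin K → SO3) (x : SO3) : ℝ :=
  (K : ℝ)⁻¹ * ∑ j, k ((s j)⁻¹ * x)

theorem memLp_kernelEstimator (hX : ∀ j, Measurable (X j)) (hk : Continuous k) (x : SO3) :
    MemLp (fun ω => kernelEstimator k (fun j => X j ω) x) 2 P :=
  (memLp_finsetSum _ fun j _ =>
    memLp_comp (hX j) (g := fun y => k (y⁻¹ * x)) (by fun_prop)).const_mul _

theorem integral_kernelEstimator (hK : 1 ≤ K) (hf : Integrable f SO3.haar)
    (hf0 : 0 ≤ᵐ[SO3.haar] f) (hX : ∀ j, Measurable (X j))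
    (hlaw : ∀ j, P.map (X j) = SO3.haar.withDensity (fun x => ENNReal.ofReal (f x)))
    (hk : Continuous k) (x : SO3) :
    ∫ ω, kernelEstimator k (fun j => X j ω) x ∂P = convSO3 f k x := by
  have hK0 : (K : ℝ) ≠ 0 := Nat.cast_ne_zero.2 (by omega)
  have hc : Continuous fun y => k (y⁻¹ * x) := by fun_prop
  simp only [kernelEstimator]
  rw [integral_const_mul, integral_finsetSum _ fun j _ =>
    (memLp_comp (hX j) hc).integrable (by norm_num)]
  simp only [integral_comp_of_density hf hf0 (hX _) (hlaw _) hc]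
  rw [Finset.sum_const, Finset.card_univ, Fintype.card_fin, nsmul_eq_mul, ← mul_assoc,
    inv_mul_cancel₀ hK0, one_mul, convSO3]

theorem variance_kernelEstimator (hK : 1 ≤ K) (hf : Integrable f SO3.haar)
    (hf0 : 0 ≤ᵐ[SO3.haar] f) (hX : ∀ j, Measurable (X j)) (hind : iIndepFun X P)
    (hlaw : ∀ j, P.map (X j) = SO3.haar.withDensity (fun x => ENNReal.ofReal (f x)))
    (hk : Continuous k) (x : SO3) :
    Var[fun ω => kernelEstimator k (fun j => X j ω) x; P] =
      (K : ℝ)⁻¹ * (convSO3 f (fun z => k z ^ 2) x - convSO3 f k x ^ 2) := by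
  have hK0 : (K : ℝ) ≠ 0 := Nat.cast_ne_zero.2 (by omega)
  have hc : Continuous fun y => k (y⁻¹ * x) := by fun_prop
  have hL (j : Fin K) : MemLp (fun ω => k ((X j ω)⁻¹ * x)) 2 P := memLp_comp (hX j) hc
  have hv (j : Fin K) : Var[fun ω => k ((X j ω)⁻¹ * x); P] =
      convSO3 f (fun z => k z ^ 2) x - convSO3 f k x ^ 2 := by
    rw [variance_eq_sub (hL j)]
    congr 1
    · exact integral_comp_of_density hf hf0 (hX j) (hlaw j) (hc.pow 2)
    · rw [integral_comp_of_density hf hf0 (hX j) (hlaw j) hc, convSO3]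
  have hs := IndepFun.variance_sum (s := Finset.univ) (μ := P) (fun j _ => hL j)
    fun i _ j _ hij => (hind.indepFun hij).comp hc.measurable hc.measurable
  simp only [kernelEstimator]
  rw [variance_const_mul]
  have he : (fun ω => ∑ j, k ((X j ω)⁻¹ * x)) = ∑ j, fun ω => k ((X j ω)⁻¹ * x) := by
    funext ω
    rw [Finset.sum_apply]
  rw [he, hs]
  simp only [hv]
  rw [Finset.sum_const, Finset.card_univ, Fintype.card_fin, nsmul_eq_mul]
  field_simp

/-- Pointwise bias–variance decomposition about an arbitrary centre `a`. It is stated in `[0, ∞]` so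
that Tonelli applies without integrability conditions. -/
theorem lintegral_kernelEstimator_sub_sq (hK : 1 ≤ K) (hf : Integrable f SO3.haar)
    (hf0 : 0 ≤ᵐ[SO3.haar] f) (hX : ∀ j, Measurable (X j)) (hind : iIndepFun X P)
    (hlaw : ∀ j, P.map (X j) = SO3.haar.withDensity (fun x => ENNReal.ofReal (f x)))
    (hk : Continuous k) (x : SO3) (a : ℝ) :
    ∫⁻ ω, ENNReal.ofReal ((kernelEstimator k (fun j => X j ω) x - a) ^ 2) ∂P =
      ENNReal.ofReal ((K : ℝ)⁻¹ * (convSO3 f (fun z => k z ^ 2) x - convSO3 f k x ^ 2)) +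
        ENNReal.ofReal ((a - convSO3 f k x) ^ 2) := by
  have hL := memLp_kernelEstimator (P := P) hX hk x
  have hLa : MemLp (fun ω => kernelEstimator k (fun j => X j ω) x - a) 2 P :=
    hL.sub (memLp_const a)
  have hv := variance_kernelEstimator hK hf hf0 hX hind hlaw hk x
  have h0 : 0 ≤ (K : ℝ)⁻¹ * (convSO3 f (fun z => k z ^ 2) x - convSO3 f k x ^ 2) := by
    rw [← hv]; exact variance_nonneg _ _
  rw [← ofReal_integral_eq_lintegral_ofReal hLa.integrable_sq (ae_of_all _ fun _ => sq_nonneg _),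
    ← ENNReal.ofReal_add h0 (sq_nonneg _), ← hv, ← variance_sub_const hL.aestronglyMeasurable a,
    variance_eq_sub hLa, integral_sub (hL.integrable (by norm_num)) (integrable_const a),
    integral_kernelEstimator hK hf hf0 hX hlaw hk]
  congr 1
  simp only [Pi.pow_apply, integral_const, probReal_univ, one_smul]
  ring

/-- The free target `g` serves twice: `g = f` gives the mean integrated squared error, and `g = f *
k` the variance term. -/
theorem lintegral_normSqSO3_kernelEstimator_sub (hK : 1 ≤ K) (hf : Integrable f SO3.haar)
    (hf0 : 0 ≤ᵐ[SO3.haar] f) (hX : ∀ j, Measurable (X j)) (hind : iIndepFun X P)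
    (hlaw : ∀ j, P.map (X j) = SO3.haar.withDensity (fun x => ENNReal.ofReal (f x)))
    (hk : Continuous k) {g : SO3 → ℝ} (hg : AEMeasurable g SO3.haar) :
    ∫⁻ ω, normSqSO3 (fun x => kernelEstimator k (fun j => X j ω) x - g x) ∂P =
      normSqSO3 (fun x => g x - convSO3 f k x) +
      ∫⁻ x, ENNReal.ofReal
        ((K : ℝ)⁻¹ * (convSO3 f (fun z => k z ^ 2) x - convSO3 f k x ^ 2)) ∂SO3.haar := by
  have hm : AEMeasurable (Function.uncurry fun ω x =>
      ENNReal.ofReal ((kernelEstimator k (fun j => X j ω) x - g x) ^ 2)) (P.prod SO3.haar) := by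
    have h1 : Measurable fun z : Ω × SO3 => kernelEstimator k (fun j => X j z.1) z.2 := by
      refine (Finset.measurable_sum _ fun j _ => ?_).const_mul _
      exact hk.measurable.comp ((((hX j).comp measurable_fst).inv).mul measurable_snd)
    exact ((h1.aemeasurable.sub hg.comp_snd).pow_const 2).ennreal_ofReal
  simp only [normSqSO3]
  rw [lintegral_lintegral_swap hm]
  simp only [lintegral_kernelEstimator_sub_sq hK hf hf0 hX hind hlaw hk]
  have hc2 : Continuous fun z => k z ^ 2 := hk.pow 2
  have hcont : Continuous fun x =>
      (K : ℝ)⁻¹ * (convSO3 f (fun z => k z ^ 2) x - convSO3 f k x ^ 2) := by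
    have := continuous_convSO3 hf hk
    have := continuous_convSO3 hf hc2
    fun_prop
  rw [lintegral_add_left hcont.measurable.ennreal_ofReal, add_comm]

/-- Since `f` has mass one, `f * k²` integrates to `‖k‖²`. The sign is recorded because
`ENNReal.ofReal` loses the value of a negative number. -/
theorem lintegral_variance_kernelEstimator (hK : 1 ≤ K) (hf : Integrable f SO3.haar)
    (hf0 : 0 ≤ᵐ[SO3.haar] f) (hf1 : ∫ x, f x ∂SO3.haar = 1) (hX : ∀ j, Measurable (X j))
    (hind : iIndepFun X P)
    (hlaw : ∀ j, P.map (X j) = SO3.haar.withDensity (fun x => ENNReal.ofReal (f x)))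
    (hk : Continuous k) :
    0 ≤ (K : ℝ)⁻¹ * ((∫ x, k x ^ 2 ∂SO3.haar) - ∫ x, convSO3 f k x ^ 2 ∂SO3.haar) ∧
    ∫⁻ x, ENNReal.ofReal
        ((K : ℝ)⁻¹ * (convSO3 f (fun z => k z ^ 2) x - convSO3 f k x ^ 2)) ∂SO3.haar =
      ENNReal.ofReal ((K : ℝ)⁻¹ *
        ((∫ x, k x ^ 2 ∂SO3.haar) - ∫ x, convSO3 f k x ^ 2 ∂SO3.haar)) := by
  have h1 := continuous_convSO3 hf hk
  have hk2 : Continuous fun z => k z ^ 2 := hk.pow 2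
  have h2 := continuous_convSO3 hf hk2
  have h3 : Integrable (fun x => convSO3 f k x ^ 2) SO3.haar :=
    Continuous.integrable_haar (by fun_prop)
  have h0 (x : SO3) : 0 ≤ (K : ℝ)⁻¹ * (convSO3 f (fun z => k z ^ 2) x - convSO3 f k x ^ 2) := by
    rw [← variance_kernelEstimator hK hf hf0 hX hind hlaw hk]; exact variance_nonneg _ _
  have hint : ∫ x, (K : ℝ)⁻¹ * (convSO3 f (fun z => k z ^ 2) x - convSO3 f k x ^ 2) ∂SO3.haar =
      (K : ℝ)⁻¹ * ((∫ x, k x ^ 2 ∂SO3.haar) - ∫ x, convSO3 f k x ^ 2 ∂SO3.haar) := by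
    rw [integral_const_mul, integral_sub h2.integrable_haar h3,
      integral_convSO3 hf hk2, hf1, one_mul]
  rw [← hint]
  refine ⟨integral_nonneg h0, ?_⟩
  refine (ofReal_integral_eq_lintegral_ofReal ?_ (ae_of_all _ h0)).symm
  exact Continuous.integrable_haar (continuous_const.mul (h2.sub (h1.pow 2)))

end Estimator

end

noncomputable section

/-! ### The heat wavelet estimator -/

theorem heatCoeff_div (t : ℝ) (ℓ : ℕ) :
    heatCoeff t ℓ / (2 * (ℓ : ℝ) + 1) = Real.exp (-((ℓ : ℝ) * (ℓ + 1) * t)) := by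
  rw [heatCoeff, mul_div_cancel_left₀ _ (by positivity)]

theorem continuous_heatKernelSO3 {t : ℝ} (ht : 0 < t) : Continuous (heatKernelSO3 t) :=
  (charSummable_heatCoeff ht).continuous

theorem fourierSq_heatKernelSO3 {t : ℝ} (ht : 0 < t) (ℓ : ℕ) :
    fourierSq (heatKernelSO3 t) ℓ = Real.exp (-((ℓ : ℝ) * (ℓ + 1) * t)) ^ 2 := by
  rw [heatKernelSO3_eq, fourierSq_charSeries (charSummable_heatCoeff ht), heatCoeff_div]

theorem fourierCoeffSO3_conv_heatKernelSO3 {f : SO3 → ℝ} (hf : Integrable f SO3.haar) {t : ℝ}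
    (ht : 0 < t) (ℓ : ℕ) (i j : Fin (2 * ℓ + 1)) :
    fourierCoeffSO3 (convSO3 f (heatKernelSO3 t)) ℓ i j =
      (Real.exp (-((ℓ : ℝ) * (ℓ + 1) * t)) : ℂ) * fourierCoeffSO3 f ℓ i j := by
  rw [heatKernelSO3_eq, fourierCoeffSO3_conv hf (charSummable_heatCoeff ht), heatCoeff_div]

/-- Three Parseval identities: in degree `ℓ`, convolution with `κ_t` multiplies the coefficients of
`f` by `e^{-ℓ(ℓ+1)t}`, so `f - f * κ_t` carries `1 - e^{-ℓ(ℓ+1)t}`. -/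
theorem hasSum_bias_add_variance {f : SO3 → ℝ} (hf : MemLp f 2 SO3.haar) {t : ℝ} (ht : 0 < t)
    (c : ℝ) :
    HasSum (fun ℓ : ℕ =>
      (2 * (ℓ : ℝ) + 1) ^ 2 * fourierSq f ℓ * (1 - Real.exp (-((ℓ : ℝ) * (ℓ + 1) * t))) ^ 2 +
      (2 * (ℓ : ℝ) + 1) ^ 2 / c * Real.exp (-(2 * (ℓ : ℝ) * (ℓ + 1) * t)) * (1 - fourierSq f ℓ))
      ((∫ x, (f x - convSO3 f (heatKernelSO3 t) x) ^ 2 ∂SO3.haar) +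
        c⁻¹ * ((∫ x, heatKernelSO3 t x ^ 2 ∂SO3.haar) -
          ∫ x, convSO3 f (heatKernelSO3 t) x ^ 2 ∂SO3.haar)) := by
  have hi : Integrable f SO3.haar := hf.integrable (by norm_num)
  have hk := continuous_heatKernelSO3 ht
  have hc := continuous_convSO3 hi hk
  have h1 := hasSum_fourierSq (hf.sub hc.memLp_haar)
  have h2 := hasSum_fourierSq hk.memLp_haar
  have h3 := hasSum_fourierSq hc.memLp_haar
  refine (h1.add ((h2.sub h3).mul_left c⁻¹)).of_eq (fun ℓ => ?_) rfl
  have e1 : fourierSq (f - convSO3 f (heatKernelSO3 t)) ℓ =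
      (1 - Real.exp (-((ℓ : ℝ) * (ℓ + 1) * t))) ^ 2 * fourierSq f ℓ := by
    refine fourierSq_eq_mul _ fun i j => ?_
    have h := fourierCoeffSO3_sub hi hc.integrable_haar ℓ i j
    rw [fourierCoeffSO3_conv_heatKernelSO3 hi ht] at h
    refine h.trans ?_
    push_cast
    ring
  rw [e1, fourierSq_heatKernelSO3 ht,
    fourierSq_eq_mul _ (fourierCoeffSO3_conv_heatKernelSO3 hi ht ℓ),
    show -(2 * (ℓ : ℝ) * (ℓ + 1) * t) = -((ℓ : ℝ) * (ℓ + 1) * t) + -((ℓ : ℝ) * (ℓ + 1) * t) by ring,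
    Real.exp_add]
  ring

theorem hasSum_pnat_bias_add_variance {f : SO3 → ℝ} (hf : MemLp f 2 SO3.haar)
    (hf1 : ∫ x, f x ∂SO3.haar = 1) {t : ℝ} (ht : 0 < t) (c : ℝ) :
    HasSum (fun l : ℕ+ =>
      (2 * (l : ℝ) + 1) ^ 2 * fourierSq f l * (1 - Real.exp (-((l : ℝ) * (l + 1) * t))) ^ 2 +
      (2 * (l : ℝ) + 1) ^ 2 / c * Real.exp (-(2 * (l : ℝ) * (l + 1) * t)) * (1 - fourierSq f l))
      ((∫ x, (f x - convSO3 f (heatKernelSO3 t) x) ^ 2 ∂SO3.haar) +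
        c⁻¹ * ((∫ x, heatKernelSO3 t x ^ 2 ∂SO3.haar) -
          ∫ x, convSO3 f (heatKernelSO3 t) x ^ 2 ∂SO3.haar)) := by
  -- Degree zero can be dropped: there `1 - e^0 = 0` kills the bias part and `fourierSq f 0 = 1` the
  -- variance part.
  refine (PNat.coe_injective.hasSum_iff fun ℓ hℓ => ?_).2 (hasSum_bias_add_variance hf ht c)
  have h0 : ℓ = 0 := by
    by_contra h
    exact hℓ ⟨⟨ℓ, Nat.pos_of_ne_zero h⟩, rfl⟩
  subst h0
  simp [fourierSq_zero_eq_one hf1]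

section Estimator

variable {Ω : Type*} [MeasurableSpace Ω] {P : Measure Ω} {f : SO3 → ℝ} {K : ℕ}
  {X : Fin K → Ω → SO3} {t : ℝ}

theorem heatWaveletEstimator_eq_kernelEstimator (hK : 1 ≤ K) (ht : 0 < t) (s : Fin K → SO3) :
    heatWaveletEstimator s t = kernelEstimator (heatKernelSO3 t) s :=
  funext fun x => heatWaveletEstimator_eq hK s ht x

variable [IsProbabilityMeasure P]

theorem meanEstimator_eq (hK : 1 ≤ K) (hf : Integrable f SO3.haar)
    (hf0 : 0 ≤ᵐ[SO3.haar] f) (hX : ∀ j, Measurable (X j))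
    (hlaw : ∀ j, P.map (X j) = SO3.haar.withDensity (fun x => ENNReal.ofReal (f x)))
    (ht : 0 < t) : meanEstimator P X t = convSO3 f (heatKernelSO3 t) := by
  funext x
  simp only [meanEstimator, heatWaveletEstimator_eq_kernelEstimator hK ht]
  exact integral_kernelEstimator hK hf hf0 hX hlaw (continuous_heatKernelSO3 ht) x

theorem varianceTerm_eq (hK : 1 ≤ K) (hf : Integrable f SO3.haar)
    (hf0 : 0 ≤ᵐ[SO3.haar] f) (hf1 : ∫ x, f x ∂SO3.haar = 1) (hX : ∀ j, Measurable (X j))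
    (hind : iIndepFun X P)
    (hlaw : ∀ j, P.map (X j) = SO3.haar.withDensity (fun x => ENNReal.ofReal (f x)))
    (ht : 0 < t) :
    varianceTerm P X t = ENNReal.ofReal ((K : ℝ)⁻¹ * ((∫ x, heatKernelSO3 t x ^ 2 ∂SO3.haar) -
      ∫ x, convSO3 f (heatKernelSO3 t) x ^ 2 ∂SO3.haar)) := by
  have hk := continuous_heatKernelSO3 ht
  simp only [varianceTerm, heatWaveletEstimator_eq_kernelEstimator hK ht,
    meanEstimator_eq hK hf hf0 hX hlaw ht]
  rw [lintegral_normSqSO3_kernelEstimator_sub hK hf hf0 hX hind hlaw hk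
    (continuous_convSO3 hf hk).measurable.aemeasurable,
    (lintegral_variance_kernelEstimator hK hf hf0 hf1 hX hind hlaw hk).2]
  -- Centred at its own mean, the estimator has no bias term.
  simp [normSqSO3]

theorem mise_eq (hK : 1 ≤ K) (hf : Integrable f SO3.haar)
    (hf0 : 0 ≤ᵐ[SO3.haar] f) (hf1 : ∫ x, f x ∂SO3.haar = 1) (hX : ∀ j, Measurable (X j))
    (hind : iIndepFun X P)
    (hlaw : ∀ j, P.map (X j) = SO3.haar.withDensity (fun x => ENNReal.ofReal (f x)))
    (ht : 0 < t) : mise P X f t = biasSq P X f t + varianceTerm P X t := by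
  have hk := continuous_heatKernelSO3 ht
  rw [varianceTerm_eq hK hf hf0 hf1 hX hind hlaw ht]
  simp only [mise, biasSq, heatWaveletEstimator_eq_kernelEstimator hK ht,
    meanEstimator_eq hK hf hf0 hX hlaw ht]
  rw [lintegral_normSqSO3_kernelEstimator_sub hK hf hf0 hX hind hlaw hk hf.aemeasurable,
    (lintegral_variance_kernelEstimator hK hf hf0 hf1 hX hind hlaw hk).2]

theorem varianceTerm_toReal (hK : 1 ≤ K) (hf : Integrable f SO3.haar)
    (hf0 : 0 ≤ᵐ[SO3.haar] f) (hf1 : ∫ x, f x ∂SO3.haar = 1) (hX : ∀ j, Measurable (X j))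
    (hind : iIndepFun X P)
    (hlaw : ∀ j, P.map (X j) = SO3.haar.withDensity (fun x => ENNReal.ofReal (f x)))
    (ht : 0 < t) :
    (varianceTerm P X t).toReal = (K : ℝ)⁻¹ * ((∫ x, heatKernelSO3 t x ^ 2 ∂SO3.haar) -
      ∫ x, convSO3 f (heatKernelSO3 t) x ^ 2 ∂SO3.haar) := by
  rw [varianceTerm_eq hK hf hf0 hf1 hX hind hlaw ht, ENNReal.toReal_ofReal
    (lintegral_variance_kernelEstimator hK hf hf0 hf1 hX hind hlaw
      (continuous_heatKernelSO3 ht)).1]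

end Estimator

/-! ### Behaviour for small `t` -/

/-- If the sum were finite, adding the convergent Parseval series of `f` divided by `c` would make
`∑ (2ℓ+1)² / c` converge, although its terms are at least `1 / c`. -/
theorem tsum_ofReal_one_sub_fourierSq_eq_top {f : SO3 → ℝ} (hf : MemLp f 2 SO3.haar)
    (hle : ∀ ℓ, fourierSq f ℓ ≤ 1) {c : ℝ} (hc : 0 < c) :
    ∑' l : ℕ+, ENNReal.ofReal ((2 * (l : ℝ) + 1) ^ 2 / c * (1 - fourierSq f l)) = ⊤ := by
  by_contra h
  have h1 := ENNReal.summable_toReal h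
  have h2 : Summable fun l : ℕ+ => (2 * (l : ℝ) + 1) ^ 2 / c * (1 - fourierSq f l) :=
    h1.congr fun l => (ENNReal.toReal_ofReal
      (mul_nonneg (by positivity) (sub_nonneg.2 (hle l))))
  have h3 : Summable fun l : ℕ+ => (2 * (l : ℝ) + 1) ^ 2 * fourierSq f l :=
    (hasSum_fourierSq hf).summable.comp_injective PNat.coe_injective
  have h4 : Summable fun _ : ℕ+ => 1 / c := by
    refine Summable.of_nonneg_of_le (fun _ => by positivity) (fun l => ?_)
      (h2.add (h3.mul_left (1 / c)))
    have h5 : (1 : ℝ) ≤ (2 * (l : ℝ) + 1) ^ 2 := one_le_pow₀ (one_le_two_mul_add_one l)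
    calc 1 / c ≤ (2 * (l : ℝ) + 1) ^ 2 / c := by gcongr
      _ = _ := by ring
  exact (one_div_pos.2 hc).ne' ((summable_const_iff _).1 h4)

/-- Some finite partial sum of `c` exceeds `r`. With the exponentials inserted, that finite sum is
continuous at `t = 0`, and it bounds `m t` from below once the nonnegative terms `b` and the tail
are dropped. -/
theorem tendsto_top_of_hasSum {c a : ℕ+ → ℝ} {b : ℝ → ℕ+ → ℝ} {m : ℝ → ℝ≥0∞}
    (hc : ∀ l, 0 ≤ c l) (htop : ∑' l, ENNReal.ofReal (c l) = ⊤)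
    (hb : ∀ t l, 0 ≤ b t l)
    (hm : ∀ t, 0 < t → HasSum (fun l => b t l + c l * Real.exp (-(a l * t))) (m t).toReal) :
    Tendsto m (𝓝[>] 0) (𝓝 ⊤) := by
  rw [ENNReal.tendsto_nhds_top_iff_nnreal]
  intro r
  have h1 := (ENNReal.summable (f := fun l => ENNReal.ofReal (c l))).hasSum
  rw [htop] at h1
  obtain ⟨s, hs⟩ := (h1.eventually (lt_mem_nhds (ENNReal.coe_lt_top (r := r)))).exists
  rw [← ENNReal.ofReal_sum_of_nonneg fun l _ => hc l] at hs
  have hcont : Continuous fun t => ENNReal.ofReal (∑ l ∈ s, c l * Real.exp (-(a l * t))) :=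
    ENNReal.continuous_ofReal.comp (by fun_prop)
  have hev : ∀ᶠ t in 𝓝[>] (0 : ℝ), (r : ℝ≥0∞) <
      ENNReal.ofReal (∑ l ∈ s, c l * Real.exp (-(a l * t))) := by
    refine nhdsWithin_le_nhds (hcont.continuousAt.eventually (lt_mem_nhds ?_))
    simpa using hs
  filter_upwards [hev, self_mem_nhdsWithin] with t ht ht0
  -- `ENNReal.ofReal_toReal_le` is valid even at `⊤`, so finiteness of `m t` is not required.
  refine ht.trans_le ((ENNReal.ofReal_le_ofReal ?_).trans ENNReal.ofReal_toReal_le)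
  refine (Finset.sum_le_sum fun l _ => le_add_of_nonneg_left (hb t l)).trans
    (sum_le_hasSum s (fun l _ => ?_) (hm t ht0))
  exact add_nonneg (hb t l) (mul_nonneg (hc l) (Real.exp_nonneg _))

end

/-! ### The main theorem -/

theorem mainTheorem2 {Ω : Type*} [MeasurableSpace Ω] (P : Measure Ω) [IsProbabilityMeasure P]
    (f : SO3 → ℝ) (hf : MemLp f 2 SO3.haar) (hf_nonneg : 0 ≤ᵐ[SO3.haar] f)
    (hf_int : ∫ x, f x ∂SO3.haar = 1)
    (K : ℕ) (hK : 1 ≤ K) (X : Fin K → Ω → SO3) (hX : ∀ k, Measurable (X k))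
    (hX_indep : iIndepFun X P)
    (hX_law : ∀ k, P.map (X k) = SO3.haar.withDensity (fun x => ENNReal.ofReal (f x))) :
    (∀ t : ℝ, 0 < t →
      -- the estimator is the kernel estimator of the heat kernel, and its mean is `f * κ_t`
      (∀ ω x, heatWaveletEstimator (fun k => X k ω) t x =
        (K : ℝ)⁻¹ * ∑ k, heatKernelSO3 t ((X k ω)⁻¹ * x)) ∧
      (∀ x, Integrable (fun ω => heatWaveletEstimator (fun k => X k ω) t x) P ∧
        meanEstimator P X t x = convSO3 f (heatKernelSO3 t) x) ∧
      -- bias and variance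
      biasSq P X f t = normSqSO3 (fun x => f x - convSO3 f (heatKernelSO3 t) x) ∧
      normSqSO3 (heatKernelSO3 t) ≠ ⊤ ∧
      normSqSO3 (convSO3 f (heatKernelSO3 t)) ≠ ⊤ ∧
      varianceTerm P X t ≠ ⊤ ∧
      (varianceTerm P X t).toReal = 1 / (K : ℝ) * ((normSqSO3 (heatKernelSO3 t)).toReal -
        (normSqSO3 (convSO3 f (heatKernelSO3 t))).toReal) ∧
      -- the mean integrated squared error
      mise P X f t = biasSq P X f t + varianceTerm P X t ∧
      mise P X f t ≠ ⊤ ∧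
      HasSum (fun l : ℕ+ =>
        (2 * (l : ℝ) + 1) ^ 2 * fourierSq f l * (1 - Real.exp (-((l : ℝ) * (l + 1) * t))) ^ 2 +
        (2 * (l : ℝ) + 1) ^ 2 / (K : ℝ) * Real.exp (-(2 * (l : ℝ) * (l + 1) * t)) *
          (1 - fourierSq f l))
        (mise P X f t).toReal) ∧
    -- behaviour as `t → 0`, in `[0, ∞]`
    (∀ l : ℕ+, fourierSq f l ≤ 1) ∧
    Tendsto (mise P X f) (𝓝[>] 0)
      (𝓝 (∑' l : ℕ+, ENNReal.ofReal ((2 * (l : ℝ) + 1) ^ 2 / (K : ℝ) * (1 - fourierSq f l)))) ∧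
    ∑' l : ℕ+, ENNReal.ofReal ((2 * (l : ℝ) + 1) ^ 2 / (K : ℝ) * (1 - fourierSq f l)) = ⊤ := by
  have hi : Integrable f SO3.haar := hf.integrable (by norm_num)
  have hle := fourierSq_le_one hi hf_nonneg hf_int
  have hK0 : (0 : ℝ) < K := Nat.cast_pos.2 hK
  have htop := tsum_ofReal_one_sub_fourierSq_eq_top hf hle hK0
  have hbias {t : ℝ} (ht : 0 < t) :
      biasSq P X f t = normSqSO3 (fun x => f x - convSO3 f (heatKernelSO3 t) x) := by
    rw [biasSq, meanEstimator_eq hK hi hf_nonneg hX hX_law ht]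
  have hsub {t : ℝ} (ht : 0 < t) :
      MemLp (fun x => f x - convSO3 f (heatKernelSO3 t) x) 2 SO3.haar :=
    hf.sub (continuous_convSO3 hi (continuous_heatKernelSO3 ht)).memLp_haar
  have hvar {t : ℝ} (ht : 0 < t) : varianceTerm P X t ≠ ⊤ := by
    rw [varianceTerm_eq hK hi hf_nonneg hf_int hX hX_indep hX_law ht]
    exact ENNReal.ofReal_ne_top
  have hmise {t : ℝ} (ht : 0 < t) :=
    mise_eq hK hi hf_nonneg hf_int hX hX_indep hX_law ht
  have hsum {t : ℝ} (ht : 0 < t) := by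
    have h := hasSum_pnat_bias_add_variance hf hf_int ht K
    rw [← varianceTerm_toReal hK hi hf_nonneg hf_int hX hX_indep hX_law ht,
      ← normSqSO3_toReal (hsub ht), ← hbias ht, ← ENNReal.toReal_add
        (by rw [hbias ht]; exact normSqSO3_ne_top (hsub ht)) (hvar ht), ← hmise ht] at h
    exact h
  refine ⟨fun t ht => ?_, fun l => hle l, ?_, htop⟩
  · have hk := continuous_heatKernelSO3 ht
    have hc := continuous_convSO3 hi hk
    refine ⟨fun ω x => heatWaveletEstimator_eq hK _ ht x, fun x => ⟨?_, ?_⟩, hbias ht,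
      normSqSO3_ne_top hk.memLp_haar, normSqSO3_ne_top hc.memLp_haar, hvar ht, ?_, hmise ht, ?_,
      hsum ht⟩
    · simp only [heatWaveletEstimator_eq_kernelEstimator hK ht]
      exact (memLp_kernelEstimator hX hk x).integrable (by norm_num)
    · rw [meanEstimator_eq hK hi hf_nonneg hX hX_law ht]
    · rw [varianceTerm_toReal hK hi hf_nonneg hf_int hX hX_indep hX_law ht,
        normSqSO3_toReal hk.memLp_haar, normSqSO3_toReal hc.memLp_haar, one_div]
    · rw [hmise ht, hbias ht]
      exact ENNReal.add_ne_top.2 ⟨normSqSO3_ne_top (hsub ht), hvar ht⟩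
  · rw [htop]
    -- Here `b` is the bias part, and `c` is the variance coefficient without its exponential.
    refine tendsto_top_of_hasSum (a := fun l : ℕ+ => 2 * (l : ℝ) * (l + 1))
      (b := fun t (l : ℕ+) => (2 * (l : ℝ) + 1) ^ 2 * fourierSq f l *
        (1 - Real.exp (-((l : ℝ) * (l + 1) * t))) ^ 2)
      (fun l => mul_nonneg (by positivity) (sub_nonneg.2 (hle l))) htop
      (fun t l => mul_nonneg (mul_nonneg (by positivity) (fourierSq_nonneg f l)) (sq_nonneg _))
      fun t ht => (hsum ht).of_eq (fun l => by ring) rfl
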